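/- For $f\in L^2(\mathbb R)$ (complex-valued) let $\widehat f(\xi)=\int_{\mathbb R} f(x)e^{-2\pi i x\xi}\,dx$ denote the Fourier transform, extended to $L^2(\mathbb R)$ by Plancherel's theorem. For $\phi\in L^2(\mathbb R)$ let $$V_2(\phi)=\Big\{\sum_{k\in\mathbb Z}c(k)\,\phi(\cdot-k)\ :\ (c(k))_{k\in\mathbb Z}\in\ell^2(\mathbb Z)\Big\},$$ where the series converge (unconditionally) in $L^2(\mathbb R)$. A set $V\subseteq L^2(\mathbb R)$ is called $\frac1n\mathbb Z$-invariant if $f(\cdot-\frac kn)\in V$ for all $f\in V$ and all $k\in\mathbb Z$. **Theorem (near-optimal integral localization).** Let $n\ge 2$ be an integer and let $\epsilon>0$, $\gamma\ge 0$, $\delta>0$ and $1\le q<\infty$ be real numbers with $1+\delta-\frac q2<\frac1{2\gamma}$ (where $\frac{1}{2\gamma}=+\infty$ if $\gamma=0$, so that the condition is void in that case). Then there exists $\phi\in L^2(\mathbb R)$ (depending on $\epsilon,\gamma,\delta,q,n$) such that $\{\phi(\cdot-k) : k\in\mathbb Z\}$ is an orthonormal basis of $V_2(\phi)$, the space $V_2(\phi)$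 is $\frac1n\mathbb Z$-invariant, and 1. $\int_{\mathbb R}|\phi(x)|^2(1+|x|)^{1-\epsilon}\,dx<\infty$, 2. $\int_{\mathbb R}|\phi(x)|(1+|x|)^{\gamma}\,dx<\infty$, 3. $\int_{\mathbb R}|\widehat\phi(\xi)|^q(1+|\xi|)^{\delta}\,d\xi<\infty$. -/

import Mathlib

open MeasureTheory FourierTransform

namespace ShiftInvariant

/-- The Hilbert space `L²(ℝ)` of complex-valued square-integrable functions. -/
abbrev L2R : Type := Lp ℂ 2 (volume : Measure ℝ)

/-- The translate `f(· - t)` of `f ∈ L²(ℝ)`. -/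
noncomputable def translate (t : ℝ) (f : L2R) : L2R :=
  Lp.compMeasurePreserving (fun x : ℝ => x - t) (measurePreserving_sub_right volume t) f

/-- The space `V₂(φ) = { ∑_{k ∈ ℤ} c(k) φ(· - k) : c ∈ ℓ²(ℤ) }`, the series converging in `L²(ℝ)`. -/
def generatedSpace (φ : L2R) : Set L2R :=
  {f | ∃ c : lp (fun _ : ℤ => ℂ) 2, HasSum (fun k : ℤ => c k • translate (k : ℝ) φ) f}

/-- `φ` is an orthonormal generator: its integer translates are an orthonormal system, and the
closed linear span of that system is `V₂(φ)`, that is, they form an orthonormal basis of `V₂(φ)`. -/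
def IsOrthonormalGenerator (φ : L2R) : Prop :=
  Orthonormal ℂ (fun k : ℤ => translate (k : ℝ) φ) ∧
    ((Submodule.span ℂ (Set.range fun k : ℤ => translate (k : ℝ) φ)).topologicalClosure : Set L2R)
      = generatedSpace φ

/-- `τ(V)`, the set of all real `t` such that `f(· - t) ∈ V` for all `f ∈ V`. -/
def invarianceSet (V : Set L2R) : Set ℝ :=
  {t | ∀ f ∈ V, translate t f ∈ V}

/-- `V` is `(1/n)ℤ`-invariant: every `k/n` with `k ∈ ℤ` belongs to `τ(V)`. -/
def IsFractionallyInvariant (n : ℕ) (V : Set L2R) : Prop :=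
  ∀ k : ℤ, (k : ℝ) / (n : ℝ) ∈ invarianceSet V

end ShiftInvariant

/-! ### Orthonormal families: closed spans and equality in Bessel's inequality. -/

section OrthonormalFamily

variable {𝕜 E ι : Type*} [RCLike 𝕜] [NormedAddCommGroup E] [InnerProductSpace 𝕜 E] {v : ι → E}

/-! The generator φ is built so that folding |φ̂|² modulo n gives the indicator of (0,1). Then ⟨φ,
φ(· - k/n)⟩ = ∫₀¹ e^{-2πiks/n} ds: the integer translates have the Gram matrix of an orthonormal
system, and Parseval for e^{-2πijs/n} on (0,1) puts φ(· - j/n) in their closed span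
(`generator_of_inner_eq`).

To reach this discontinuous indicator with smooth functions, (0,1) is split into bumps of width r ≈
ρ^j accumulating at both ends, with squares summing to 1 (`hasSum_sq_endBump`). The j-th bump at
each end is copied into 2N cells nk + (0,1), N = L^j, with amplitudes of square sum 1 (`piece`).
Folding undoes the copying (`integral_exp_mul_norm_sq_piece`); on the x side a piece is a wave of
height r and width 1/r times a trigonometric polynomial (`norm_integral_exp_mul_piece`). Amplitudes
taken from a squared Dirichlet kernel are O(N^{-1/2}), and the polynomial has mean modulus
O(N^{-1/2}) (`exists_flat_coefficients`).

Up to constants, a piece contributes r^{1-s} to the weighted L² integral, r^{-γ}N^{-1/2} to the L¹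
integral and rN^{1+δ-q/2} to the Fourier integral. These decay geometrically in j if s < 1,
ρ^{-γ}L^{-1/2} < 1 and ρL^{1+δ-q/2} < 1. With ρ = L^{-1/β} the last two say 2γ < β and (1+δ-q/2)β <
1, and such a β exists by hypothesis (`exists_scales`). -/

theorem Orthonormal.mem_closure_span_iff [CompleteSpace E] (hv : Orthonormal 𝕜 v) (f : E) :
    f ∈ (Submodule.span 𝕜 (Set.range v)).topologicalClosure ↔
      ∃ c : lp (fun _ : ι => 𝕜) 2, HasSum (fun i => c i • v i) f := by
  -- The synthesis map from ℓ² is an isometry, so its range is closed and is the whole closed span.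
  have hr := hv.orthogonalFamily.range_linearIsometry
  have hspan : (⨆ i, LinearMap.range (LinearIsometry.toSpanSingleton 𝕜 E (hv.1 i)).toLinearMap)
      = Submodule.span 𝕜 (Set.range v) := by
    simp [← LinearMap.span_singleton_eq_range, ← Submodule.span_iUnion]
  rw [← hspan, ← hr]
  constructor
  · rintro ⟨c, rfl⟩
    exact ⟨c, by simpa using hv.orthogonalFamily.hasSum_linearIsometry c⟩
  · rintro ⟨c, hc⟩
    refine ⟨c, HasSum.unique ?_ hc⟩
    simpa using hv.orthogonalFamily.hasSum_linearIsometry c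

theorem Orthonormal.norm_sub_sum_inner_sq (hv : Orthonormal 𝕜 v) (x : E) (s : Finset ι) :
    ‖x - ∑ i ∈ s, inner 𝕜 (v i) x • v i‖ ^ 2 = ‖x‖ ^ 2 - ∑ i ∈ s, ‖inner 𝕜 (v i) x‖ ^ 2 := by
  have h1 : inner 𝕜 (∑ i ∈ s, inner 𝕜 (v i) x • v i) x
      = ((∑ i ∈ s, ‖inner 𝕜 (v i) x‖ ^ 2 : ℝ) : 𝕜) := by
    rw [sum_inner]
    push_cast
    refine Finset.sum_congr rfl fun i _ => ?_
    rw [inner_smul_left, RCLike.conj_mul]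
  have h2 : ‖∑ i ∈ s, inner 𝕜 (v i) x • v i‖ ^ 2 = ∑ i ∈ s, ‖inner 𝕜 (v i) x‖ ^ 2 := by
    have := hv.inner_sum (fun i => inner 𝕜 (v i) x) (fun i => inner 𝕜 (v i) x) s
    rw [inner_self_eq_norm_sq_to_K] at this
    have h3 : ((‖∑ i ∈ s, inner 𝕜 (v i) x • v i‖ ^ 2 : ℝ) : 𝕜)
        = ((∑ i ∈ s, ‖inner 𝕜 (v i) x‖ ^ 2 : ℝ) : 𝕜) := by
      push_cast
      rw [this]
      exact Finset.sum_congr rfl fun i _ => RCLike.conj_mul _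
    exact_mod_cast h3
  rw [@norm_sub_sq 𝕜, ← inner_conj_symm, h1, h2]
  simp
  ring

/-- A vector for which equality holds in Bessel's inequality lies in the closed span. -/
theorem Orthonormal.mem_closure_span_of_hasSum (hv : Orthonormal 𝕜 v) {x : E}
    (hx : HasSum (fun i => ‖inner 𝕜 (v i) x‖ ^ 2) (‖x‖ ^ 2)) :
    x ∈ (Submodule.span 𝕜 (Set.range v)).topologicalClosure := by
  have h : Filter.Tendsto (fun s : Finset ι => ∑ i ∈ s, inner 𝕜 (v i) x • v i)
      Filter.atTop (nhds x) := by
    rw [tendsto_iff_norm_sub_tendsto_zero]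
    have h0 : Filter.Tendsto (fun s : Finset ι =>
        √(‖x‖ ^ 2 - ∑ i ∈ s, ‖inner 𝕜 (v i) x‖ ^ 2)) Filter.atTop (nhds 0) := by
      have := (Filter.Tendsto.const_sub (‖x‖ ^ 2) hx).sqrt
      simpa using this
    refine h0.congr fun s => ?_
    rw [← hv.norm_sub_sum_inner_sq, Real.sqrt_sq (norm_nonneg _), norm_sub_rev]
  refine mem_closure_of_tendsto h (Filter.Eventually.of_forall fun s => ?_)
  exact Submodule.sum_mem _ fun i _ => Submodule.smul_mem _ _ (Submodule.subset_span ⟨i, rfl⟩)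

end OrthonormalFamily

/-! ### Translations on L²(ℝ) and a Gram criterion for fractional invariance. -/

namespace ShiftInvariant

/-- Translation as a linear isometry of `L²(ℝ)`. -/
noncomputable def translateₗᵢ (t : ℝ) : L2R →ₗᵢ[ℂ] L2R :=
  Lp.compMeasurePreservingₗᵢ ℂ (fun x : ℝ => x - t) (measurePreserving_sub_right volume t)

theorem translateₗᵢ_apply (t : ℝ) (f : L2R) : translateₗᵢ t f = translate t f := rfl

theorem coeFn_translate (t : ℝ) (f : L2R) :
    (translate t f : ℝ → ℂ) =ᵐ[volume] fun x => f (x - t) :=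
  Lp.coeFn_compMeasurePreserving f (measurePreserving_sub_right volume t)

theorem translate_translate (s t : ℝ) (f : L2R) :
    translate s (translate t f) = translate (s + t) f := by
  refine Lp.ext ?_
  have h := (measurePreserving_sub_right volume s).quasiMeasurePreserving.ae (coeFn_translate t f)
  filter_upwards [coeFn_translate s (translate t f), coeFn_translate (s + t) f, h] with x h1 h2 h3
  rw [h1, h2, h3, sub_sub]

theorem inner_translate (a b : ℝ) (f g : L2R) :
    inner ℂ (translate a f) (translate b g) = inner ℂ f (translate (b - a) g) := by
  have : translate b g = translateₗᵢ a (translate (b - a) g) := by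
    rw [translateₗᵢ_apply, translate_translate, add_sub_cancel]
  rw [this, ← translateₗᵢ_apply, LinearIsometry.inner_map_map]

/-- Translations commute and are continuous, and the closed span is stable under integer shifts, so
it suffices to test the generator. -/
theorem translate_mem_generatedSpace {φ : L2R} (hφ : IsOrthonormalGenerator φ) {t : ℝ}
    (ht : translate t φ ∈ generatedSpace φ) : t ∈ invarianceSet (generatedSpace φ) := by
  have hV := hφ.2
  set V := (Submodule.span ℂ (Set.range fun k : ℤ => translate (k : ℝ) φ)).topologicalClosure
  have key : ∀ (s : ℝ), (∀ k : ℤ, translate (s + k) φ ∈ V) → ∀ f ∈ V, translate s f ∈ V := by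
    intro s hs f hf
    have hle : V ≤ V.comap (translateₗᵢ s).toLinearMap := by
      refine Submodule.topologicalClosure_minimal _ ?_ ?_
      · rw [Submodule.span_le]
        rintro _ ⟨k, rfl⟩
        simpa [translateₗᵢ_apply, translate_translate] using hs k
      · exact (Submodule.isClosed_topologicalClosure _).preimage (translateₗᵢ s).continuous
    exact hle hf
  have hint : ∀ (k : ℤ), ∀ f ∈ V, translate (k : ℝ) f ∈ V := by
    intro k
    refine key k fun l => Submodule.le_topologicalClosure _ (Submodule.subset_span ⟨k + l, ?_⟩)
    simp
  rw [← hV] at ht ⊢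
  refine key t fun k => ?_
  rw [add_comm, ← translate_translate]
  exact hint k _ ht

theorem integral_exp_int (a : ℝ) (k : ℤ) :
    ∫ s in a..(a + 1), Complex.exp (2 * Real.pi * Complex.I * k * s) = if k = 0 then 1 else 0 := by
  split_ifs with hk
  · simp [hk]
  · have hc : (2 * Real.pi * Complex.I * k : ℂ) ≠ 0 := by
      simp [hk, Real.pi_ne_zero]
    rw [integral_exp_mul_complex hc]
    have : Complex.exp (2 * Real.pi * Complex.I * k) = 1 := by
      rw [Complex.exp_eq_one_iff]
      exact ⟨k, by ring⟩
    push_cast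
    simp [mul_add, Complex.exp_add, this]

/-- Multiples of n among the k give orthonormality. For the shift by j/n, the coefficients against
the integer translates are the Fourier coefficients on (0,1) of a unimodular function; Parseval
makes their squares sum to 1, which is equality in Bessel's inequality. -/
theorem generator_of_inner_eq {n : ℕ} (hn : n ≠ 0) {φ : L2R}
    (h : ∀ k : ℤ, inner ℂ φ (translate ((k : ℝ) / n) φ) =
      ∫ s in (0 : ℝ)..1, Complex.exp (2 * Real.pi * Complex.I * (-((k : ℝ) / n) : ℝ) * s)) :
    IsOrthonormalGenerator φ ∧ IsFractionallyInvariant n (generatedSpace φ) := by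
  have hn' : (n : ℝ) ≠ 0 := by exact_mod_cast hn
  have hort : Orthonormal ℂ (fun k : ℤ => translate (k : ℝ) φ) := by
    classical
    rw [orthonormal_iff_ite]
    intro i j
    have := h (n * (j - i))
    rw [inner_translate]
    have e : (j : ℝ) - i = ((n * (j - i) : ℤ) : ℝ) / n := by
      push_cast; field_simp
    rw [e, this, ← e]
    have := integral_exp_int 0 (-(j - i))
    push_cast [zero_add] at this ⊢
    rw [this]
    simp [sub_eq_zero]
  have hgen : IsOrthonormalGenerator φ := by
    refine ⟨hort, ?_⟩
    ext f
    exact hort.mem_closure_span_iff f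
  refine ⟨hgen, fun j => translate_mem_generatedSpace hgen ?_⟩
  rw [← hgen.2]
  refine hort.mem_closure_span_of_hasSum ?_
  have h01 : (0 : ℝ) < 1 := one_pos
  have hnorm : ∀ s : ℝ,
      ‖Complex.exp (2 * Real.pi * Complex.I * (-((j : ℝ) / n) : ℝ) * s)‖ = 1 := by
    intro s
    rw [← Complex.norm_exp_ofReal_mul_I (2 * Real.pi * (-((j : ℝ) / n)) * s)]
    congr 2
    push_cast
    ring
  have hc : Continuous fun s : ℝ =>
      Complex.exp (2 * Real.pi * Complex.I * (-((j : ℝ) / n) : ℝ) * s) := by fun_prop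
  have hP := hasSum_sq_fourierCoeffOn (f := fun s : ℝ =>
      Complex.exp (2 * Real.pi * Complex.I * (-((j : ℝ) / n) : ℝ) * s)) h01
    (MemLp.of_bound hc.aestronglyMeasurable 1 (Filter.Eventually.of_forall fun s => (hnorm s).le))
  have hφ1 : ‖translate ((j : ℝ) / n) φ‖ = 1 := by
    have h0 : ‖translate ((0 : ℤ) : ℝ) φ‖ = 1 := hort.1 0
    rw [← translateₗᵢ_apply, LinearIsometry.norm_map] at h0 ⊢
    exact h0
  have hval : (1 - 0 : ℝ)⁻¹ • ∫ s in (0 : ℝ)..1,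
      ‖Complex.exp (2 * Real.pi * Complex.I * (-((j : ℝ) / n) : ℝ) * s)‖ ^ 2 = 1 := by
    simp only [hnorm]
    simp
  rw [hval] at hP
  rw [hφ1, one_pow]
  -- The coefficient against the k-th translate is the Fourier coefficient of index -k.
  have hP' := (Equiv.neg ℤ).hasSum_iff.mpr hP
  convert hP' using 1
  funext k
  simp only [Function.comp_apply, Equiv.neg_apply]
  have e : (j : ℝ) / n - k = ((j - n * k : ℤ) : ℝ) / n := by
    push_cast
    field_simp
  rw [inner_translate, e, h, fourierCoeffOn_eq_integral, ← e]
  congr 2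
  simp only [sub_zero, div_one, one_smul, smul_eq_mul, neg_neg, fourier_coe_apply]
  refine intervalIntegral.integral_congr fun s _ => ?_
  rw [← Complex.exp_add]
  congr 1
  push_cast
  ring

end ShiftInvariant

/-! ### Weighted norms of series of L² functions. -/

theorem HasSum.bool_prod {ι M : Type*} [AddCommMonoid M] [TopologicalSpace M] [ContinuousAdd M]
    {f : Bool × ι → M} {a b : M} (h₀ : HasSum (fun i => f (false, i)) a)
    (h₁ : HasSum (fun i => f (true, i)) b) : HasSum f (a + b) :=
  (Equiv.boolProdEquivSum ι).symm.hasSum_iff.mp (HasSum.sum h₀ h₁)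

theorem Summable.comp_bool_prod_snd {ι : Type*} {f : ι → ℝ} (hf : Summable f) :
    Summable fun i : Bool × ι => f i.2 :=
  (HasSum.bool_prod (f := fun i : Bool × ι => f i.2) hf.hasSum hf.hasSum).summable

namespace ShiftInvariant

section WeightedNorms

/-- The measure `(1 + |x|) ^ a dx`. -/
noncomputable def polyMeasure (a : ℝ) : Measure ℝ :=
  volume.withDensity fun x => ENNReal.ofReal ((1 + |x|) ^ a)

theorem measurable_ofReal_one_add_abs_rpow (a : ℝ) :
    Measurable fun x : ℝ => ENNReal.ofReal ((1 + |x|) ^ a) := by fun_prop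

theorem polyMeasure_absolutelyContinuous (a : ℝ) : polyMeasure a ≪ volume :=
  withDensity_absolutelyContinuous _ _

theorem lintegral_polyMeasure (a : ℝ) (g : ℝ → ENNReal) :
    ∫⁻ x, g x ∂(polyMeasure a) = ∫⁻ x, ENNReal.ofReal ((1 + |x|) ^ a) * g x :=
  lintegral_withDensity_eq_lintegral_mul_non_measurable _ (measurable_ofReal_one_add_abs_rpow a)
    (Filter.Eventually.of_forall fun _ => ENNReal.ofReal_lt_top) g

theorem eLpNorm_polyMeasure {p : ℝ} (hp : 1 ≤ p) (a : ℝ) (f : ℝ → ℂ) :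
    eLpNorm f (ENNReal.ofReal p) (polyMeasure a) =
      (∫⁻ x, ENNReal.ofReal (‖f x‖ ^ p * (1 + |x|) ^ a)) ^ (1 / p) := by
  have hp0 : 0 < p := by linarith
  rw [eLpNorm_eq_lintegral_rpow_enorm_toReal (by simpa using hp0) ENNReal.ofReal_ne_top,
    ENNReal.toReal_ofReal hp0.le, lintegral_polyMeasure]
  congr 2
  funext x
  rw [mul_comm, ENNReal.ofReal_mul (by positivity), ← ofReal_norm,
    ENNReal.ofReal_rpow_of_nonneg (norm_nonneg _) hp0.le]

/-- Absolute convergence in L² gives convergence almost everywhere; Fatou's lemma then carries the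
triangle inequality from partial sums to the sum, in a norm unrelated to the L² one. -/
theorem eLpNorm_tsum_le {ι : Type*} [Countable ι] {F : ι → L2R} (hF : Summable fun i => ‖F i‖)
    {μ : Measure ℝ} (hμ : μ ≪ volume) {p : ENNReal} (hp : 1 ≤ p) :
    eLpNorm (∑' i, F i : L2R) p μ ≤ ∑' i, eLpNorm (F i) p μ := by
  have hlim : ∀ᵐ x ∂μ, HasSum (fun i => F i x) ((∑' i, F i : L2R) x) :=
    hμ.ae_le (Lp.hasSum_coeFn_tsum (by
      simpa only [← ofReal_norm] using hF.tsum_ofReal_ne_top))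
  have hm : ∀ i, AEStronglyMeasurable (F i) μ := fun i =>
    (Lp.aestronglyMeasurable (F i)).mono_ac hμ
  refine Lp.eLpNorm_le_of_ae_tendsto (u := Filter.atTop)
    (f := fun (s : Finset ι) => ∑ i ∈ s, (F i : ℝ → ℂ)) (Filter.Eventually.of_forall fun s => ?_)
    (fun s => Finset.aestronglyMeasurable_sum s fun i _ => hm i) ?_
  · exact (eLpNorm_sum_le (fun i _ => hm i) hp).trans (ENNReal.sum_le_tsum s)
  · filter_upwards [hlim] with x hx
    simpa [HasSum] using hx

/-- Taking p-th roots turns the ratio θ into θ^{1/p} < 1, so the weighted norms are summable. All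
three localization claims reduce to this. -/
theorem integrable_tsum_of_geometric {F : Bool × ℕ → L2R} (hF : Summable fun i => ‖F i‖)
    {p : ℝ} (hp : 1 ≤ p) (a : ℝ) {C θ : ℝ} (hC : 0 ≤ C) (hθ0 : 0 ≤ θ) (hθ1 : θ < 1)
    (hbound : ∀ i, ∫⁻ x, ENNReal.ofReal (‖F i x‖ ^ p * (1 + |x|) ^ a) ≤
      ENNReal.ofReal (C * θ ^ i.2)) :
    Integrable (fun x : ℝ => ‖(∑' i, F i : L2R) x‖ ^ p * (1 + |x|) ^ a) volume := by
  have hp0 : 0 < p := by linarith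
  have h1 : ∀ i, eLpNorm (F i) (ENNReal.ofReal p) (polyMeasure a) ≤
      ENNReal.ofReal (C ^ (1 / p) * (θ ^ (1 / p)) ^ i.2) := by
    intro i
    rw [eLpNorm_polyMeasure hp]
    refine (ENNReal.rpow_le_rpow (hbound i) (by positivity)).trans_eq ?_
    rw [ENNReal.ofReal_rpow_of_nonneg (by positivity) (by positivity),
      Real.mul_rpow hC (by positivity), ← Real.rpow_natCast, ← Real.rpow_natCast,
      ← Real.rpow_mul hθ0, ← Real.rpow_mul hθ0, mul_comm (i.2 : ℝ)]
  have hs : Summable fun i : Bool × ℕ => C ^ (1 / p) * (θ ^ (1 / p)) ^ i.2 :=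
    ((summable_geometric_of_lt_one (by positivity)
      (Real.rpow_lt_one hθ0 hθ1 (by positivity))).mul_left _).comp_bool_prod_snd
  have h2 : eLpNorm (∑' i, F i : L2R) (ENNReal.ofReal p) (polyMeasure a) < ⊤ := by
    refine ((eLpNorm_tsum_le hF (polyMeasure_absolutelyContinuous a) (by simpa using hp)).trans
      (ENNReal.tsum_le_tsum h1)).trans_lt ?_
    rw [← ENNReal.ofReal_tsum_of_nonneg (fun i => by positivity) hs]
    exact ENNReal.ofReal_lt_top
  rw [eLpNorm_polyMeasure hp, ENNReal.rpow_lt_top_iff_of_pos (by positivity)] at h2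
  have hm : AEStronglyMeasurable (fun x : ℝ => ‖(∑' i, F i : L2R) x‖ ^ p * (1 + |x|) ^ a)
      volume := by
    refine AEStronglyMeasurable.mul ?_ (by
      have : Measurable fun x : ℝ => (1 + |x|) ^ a := by fun_prop
      exact this.aestronglyMeasurable)
    exact ((Lp.aestronglyMeasurable _).norm.aemeasurable.pow_const p).aestronglyMeasurable
  exact ⟨hm, (hasFiniteIntegral_iff_ofReal
    (Filter.Eventually.of_forall fun x => by positivity)).2 h2⟩

end WeightedNorms

/-! ### L² functions with prescribed smooth Fourier transform. -/

section Assembly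

open scoped ComplexConjugate ContDiff

/-- The `L²` function whose Fourier transform is the Schwartz function `v`. -/
noncomputable def invFourierLp (v : SchwartzMap ℝ ℂ) : L2R := (𝓕⁻ v).toLp 2

theorem invFourierLp_eq (v : SchwartzMap ℝ ℂ) : invFourierLp v = 𝓕⁻ (v.toLp 2 : L2R) :=
  (SchwartzMap.toLp_fourierInv_eq v).symm

theorem fourier_invFourierLp (v : SchwartzMap ℝ ℂ) : 𝓕 (invFourierLp v) = (v.toLp 2 : L2R) := by
  rw [invFourierLp_eq, fourier_fourierInv_eq]

theorem fourierInv_real_apply (f : ℝ → ℂ) (x : ℝ) :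
    𝓕⁻ f x = ∫ ξ : ℝ, Complex.exp (2 * Real.pi * Complex.I * x * ξ) * f ξ := by
  rw [Real.fourierInv_eq']
  refine integral_congr_ae (Filter.Eventually.of_forall fun ξ => ?_)
  simp only [smul_eq_mul, RCLike.inner_apply, conj_trivial]
  congr 2
  push_cast
  ring

theorem coeFn_invFourierLp (v : SchwartzMap ℝ ℂ) :
    (invFourierLp v : ℝ → ℂ) =ᵐ[volume]
      fun x => ∫ ξ : ℝ, Complex.exp (2 * Real.pi * Complex.I * x * ξ) * v ξ := by
  filter_upwards [(𝓕⁻ v).coeFn_toLp 2 volume] with x hx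
  rw [invFourierLp, hx, SchwartzMap.fourierInv_coe, fourierInv_real_apply]

theorem inner_invFourierLp (v w : SchwartzMap ℝ ℂ) :
    inner ℂ (invFourierLp v) (invFourierLp w) = ∫ ξ, conj (v ξ) * w ξ := by
  rw [← MeasureTheory.Lp.inner_fourier_eq, fourier_invFourierLp, fourier_invFourierLp,
    SchwartzMap.inner_toL2_toL2_eq v w volume]
  simp [RCLike.inner_apply, mul_comm]

/-- Multiplication of a compactly supported smooth function by a character. -/
noncomputable def modulate (t : ℝ) (v : SchwartzMap ℝ ℂ) (hv : HasCompactSupport v) :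
    SchwartzMap ℝ ℂ :=
  (hv.mul_left
      (f := fun ξ : ℝ => Complex.exp (2 * Real.pi * Complex.I * (-t : ℝ) * ξ))).toSchwartzMap
    (by
      have h1 := v.smooth ⊤
      have h2 : ContDiff ℝ ∞ fun ξ : ℝ =>
          Complex.exp (2 * Real.pi * Complex.I * (-t : ℝ) * ξ) := by
        have : ContDiff ℝ ∞ fun ξ : ℝ => (ξ : ℂ) := Complex.ofRealCLM.contDiff
        fun_prop
      exact h2.mul h1)

theorem modulate_apply (t : ℝ) (v : SchwartzMap ℝ ℂ) (hv : HasCompactSupport v) (ξ : ℝ) :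
    modulate t v hv ξ = Complex.exp (2 * Real.pi * Complex.I * (-t : ℝ) * ξ) * v ξ := rfl

theorem translate_invFourierLp (t : ℝ) (v : SchwartzMap ℝ ℂ) (hv : HasCompactSupport v) :
    translate t (invFourierLp v) = invFourierLp (modulate t v hv) := by
  refine Lp.ext ?_
  have h := (measurePreserving_sub_right volume t).quasiMeasurePreserving.ae (coeFn_invFourierLp v)
  filter_upwards [coeFn_translate t (invFourierLp v), coeFn_invFourierLp (modulate t v hv), h]
    with x h1 h2 h3
  rw [h1, h2, h3]
  refine integral_congr_ae (Filter.Eventually.of_forall fun ξ => ?_)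
  simp only [modulate_apply]
  rw [← mul_assoc, ← Complex.exp_add]
  congr 2
  push_cast
  ring

/-- Translation is modulation in frequency and does not enlarge supports, so by Plancherel the cross
terms vanish and only the diagonal remains. -/
theorem inner_translate_tsum {ι : Type*} {v : ι → SchwartzMap ℝ ℂ}
    (hv : ∀ i, HasCompactSupport (v i)) (hsum : Summable fun i => ‖invFourierLp (v i)‖)
    (hdisj : ∀ i j, i ≠ j → ∀ ξ, v i ξ = 0 ∨ v j ξ = 0) {t : ℝ} {A : ℂ}
    (hA : HasSum (fun i => ∫ ξ : ℝ, Complex.exp (2 * Real.pi * Complex.I * (-t : ℝ) * ξ) *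
      ((‖v i ξ‖ ^ 2 : ℝ) : ℂ)) A) :
    inner ℂ (∑' i, invFourierLp (v i)) (translate t (∑' i, invFourierLp (v i))) = A := by
  have hs : HasSum (fun i => invFourierLp (v i)) (∑' i, invFourierLp (v i)) :=
    hsum.of_norm.hasSum
  have hst : HasSum (fun i => translate t (invFourierLp (v i)))
      (translate t (∑' i, invFourierLp (v i))) :=
    hs.mapL (translateₗᵢ t).toContinuousLinearMap
  have hpair : ∀ i j, inner ℂ (invFourierLp (v i)) (translate t (invFourierLp (v j))) =
      ∫ ξ : ℝ, conj (v i ξ) *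
        (Complex.exp (2 * Real.pi * Complex.I * (-t : ℝ) * ξ) * v j ξ) := by
    intro i j
    rw [translate_invFourierLp t (v j) (hv j), inner_invFourierLp]
    rfl
  have hzero : ∀ i j, j ≠ i →
      inner ℂ (invFourierLp (v i)) (translate t (invFourierLp (v j))) = 0 := by
    intro i j hij
    rw [hpair]
    refine integral_eq_zero_of_ae (Filter.Eventually.of_forall fun ξ => ?_)
    rcases hdisj j i hij ξ with h | h <;> simp [h]
  have hrow : ∀ i, inner ℂ (invFourierLp (v i)) (translate t (∑' i, invFourierLp (v i))) =
      ∫ ξ : ℝ, Complex.exp (2 * Real.pi * Complex.I * (-t : ℝ) * ξ) *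
        ((‖v i ξ‖ ^ 2 : ℝ) : ℂ) := by
    intro i
    have h1 := hst.mapL (innerSL ℂ (invFourierLp (v i)))
    have h2 := hasSum_single (f := fun j => innerSL ℂ (invFourierLp (v i))
      (translate t (invFourierLp (v j)))) i (fun j hj => hzero i j hj)
    rw [innerSL_apply_apply] at h1
    rw [h1.unique h2, innerSL_apply_apply, hpair]
    refine integral_congr_ae (Filter.Eventually.of_forall fun ξ => ?_)
    simp only
    rw [← mul_assoc, mul_comm (conj _), mul_assoc, mul_comm (conj _), Complex.mul_conj]
    rw [Complex.normSq_eq_norm_sq]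
  refine HasSum.unique ?_ hA
  have h3 := hs.mapL (innerSL ℂ (translate t (∑' i, invFourierLp (v i))))
  have h4 := Complex.hasSum_conj'.mpr h3
  simp only [innerSL_apply_apply, inner_conj_symm] at h4
  simpa only [hrow] using h4

end Assembly

end ShiftInvariant

/-! ### Trigonometric polynomials against a decaying weight; flat coefficients. -/

namespace ShiftInvariant

section TrigonometricPolynomials

open scoped ComplexConjugate

/-- The trigonometric polynomial `∑_{m < M} a m e^{2πimy}`. -/
noncomputable def trigPoly (M : ℕ) (a : ℕ → ℂ) (y : ℝ) : ℂ :=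
  ∑ m ∈ Finset.range M, a m * Complex.exp (2 * Real.pi * Complex.I * m * y)

theorem continuous_trigPoly (M : ℕ) (a : ℕ → ℂ) : Continuous (trigPoly M a) := by
  unfold trigPoly
  fun_prop

theorem integral_norm_sq_trigPoly {d : ℕ} (hd : d ≠ 0) (M : ℕ) (a : ℕ → ℂ) (t : ℝ) :
    ∫ x in t..(t + 1), ‖trigPoly M a (d * x)‖ ^ 2 = ∑ m ∈ Finset.range M, ‖a m‖ ^ 2 := by
  have hexp : ∀ x : ℝ, ((‖trigPoly M a (d * x)‖ ^ 2 : ℝ) : ℂ) =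
      ∑ k ∈ Finset.range M, ∑ l ∈ Finset.range M, (a k * conj (a l)) *
        Complex.exp (2 * Real.pi * Complex.I * ((d * ((k : ℤ) - l) : ℤ) : ℂ) * x) := by
    intro x
    rw [← Complex.normSq_eq_norm_sq, ← Complex.mul_conj, trigPoly, map_sum,
      Finset.sum_mul_sum]
    refine Finset.sum_congr rfl fun k _ => Finset.sum_congr rfl fun l _ => ?_
    rw [map_mul, ← Complex.exp_conj, mul_mul_mul_comm, ← Complex.exp_add]
    congr 2
    simp only [map_mul, Complex.conj_I, Complex.conj_ofReal, map_natCast, map_ofNat]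
    push_cast
    ring
  have key : ((∫ x in t..(t + 1), ‖trigPoly M a (d * x)‖ ^ 2 : ℝ) : ℂ) =
      ((∑ m ∈ Finset.range M, ‖a m‖ ^ 2 : ℝ) : ℂ) := by
    rw [← intervalIntegral.integral_ofReal]
    simp only [hexp]
    rw [intervalIntegral.integral_finsetSum]
    swap
    · intro k _
      exact Continuous.intervalIntegrable (by fun_prop) _ _
    rw [Complex.ofReal_sum]
    refine Finset.sum_congr rfl fun k hk => ?_
    rw [intervalIntegral.integral_finsetSum]
    swap
    · intro k _
      exact Continuous.intervalIntegrable (by fun_prop) _ _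
    rw [Finset.sum_eq_single k]
    · rw [intervalIntegral.integral_const_mul, integral_exp_int, if_pos (by simp), mul_one,
        Complex.mul_conj, Complex.normSq_eq_norm_sq]
    · intro l _ hl
      rw [intervalIntegral.integral_const_mul, integral_exp_int, if_neg, mul_zero]
      have : (k : ℤ) - l ≠ 0 := by omega
      exact mul_ne_zero (by exact_mod_cast hd) this
    · exact fun h => absurd hk h
  exact_mod_cast key

/-- The total mass of `(1 + |x|) ^ (-2)`. -/
noncomputable def decayMass : ℝ := ∫ x : ℝ, (1 + |x|) ^ (-2 : ℝ)

theorem integrable_decay : Integrable fun x : ℝ => (1 + |x|) ^ (-2 : ℝ) := by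
  simpa using integrable_one_add_norm (E := ℝ) (μ := volume) (r := 2) (by simp)

theorem decayMass_nonneg : 0 ≤ decayMass := integral_nonneg fun x => by positivity

theorem lintegral_decay {r : ℝ} (hr : 0 < r) :
    ∫⁻ x : ℝ, ENNReal.ofReal ((1 + r * |x|) ^ (-2 : ℝ)) = ENNReal.ofReal (decayMass / r) := by
  have h1 : (fun x : ℝ => (1 + r * |x|) ^ (-2 : ℝ)) =
      fun x : ℝ => (fun y : ℝ => (1 + |y|) ^ (-2 : ℝ)) (r * x) := by
    funext x
    simp [abs_mul, abs_of_pos hr]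
  rw [← ofReal_integral_eq_lintegral_ofReal]
  · rw [h1, Measure.integral_comp_mul_left (fun y : ℝ => (1 + |y|) ^ (-2 : ℝ)) r,
      abs_of_pos (inv_pos.2 hr), decayMass, smul_eq_mul,
      inv_mul_eq_div]
  · rw [h1]
    exact integrable_decay.comp_mul_left' hr.ne'
  · exact Filter.Eventually.of_forall fun x => by positivity

theorem decay_le_of_dist_le_one {r x y : ℝ} (hr : 0 < r) (hr1 : r ≤ 1) (hxy : |x - y| ≤ 1) :
    (1 + r * |x|) ^ (-2 : ℝ) ≤ 4 * (1 + r * |y|) ^ (-2 : ℝ) := by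
  have h1 : 1 + r * |y| ≤ 2 * (1 + r * |x|) := by
    have h2 : |y| ≤ |x| + 1 := by
      have := abs_sub_abs_le_abs_sub y x
      rw [abs_sub_comm] at this
      linarith
    nlinarith [abs_nonneg x, mul_nonneg hr.le (abs_nonneg x)]
  have hx : 0 < 1 + r * |x| := by positivity
  have hy : 0 < 1 + r * |y| := by positivity
  rw [Real.rpow_neg hx.le, Real.rpow_neg hy.le, Real.rpow_two, Real.rpow_two,
    ← div_eq_mul_inv, inv_eq_one_div, div_le_div_iff₀ (by positivity) (by positivity)]
  nlinarith

/-- On each unit interval the polynomial has the same mean square, while the weight varies by a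
factor of at most 4 because r ≤ 1. Replacing the weight by its value at the left endpoint and back
costs 4 · 4 = 16. -/
theorem lintegral_trigPoly_mul_decay_le {d : ℕ} (hd : d ≠ 0) (M : ℕ) (a : ℕ → ℂ) {r : ℝ}
    (hr : 0 < r) (hr1 : r ≤ 1) :
    ∫⁻ x : ℝ, ENNReal.ofReal (‖trigPoly M a (d * x)‖ ^ 2 * (1 + r * |x|) ^ (-2 : ℝ)) ≤
      ENNReal.ofReal (16 * decayMass / r * ∑ m ∈ Finset.range M, ‖a m‖ ^ 2) := by
  set S := ∑ m ∈ Finset.range M, ‖a m‖ ^ 2 with hS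
  have hS0 : 0 ≤ S := Finset.sum_nonneg fun _ _ => by positivity
  set W : ℝ → ℝ := fun x => (1 + r * |x|) ^ (-2 : ℝ) with hW
  have hW0 : ∀ x, 0 ≤ W x := fun x => by positivity
  have hWm : Measurable W := by fun_prop
  have hsplit : ∀ g : ℝ → ENNReal,
      ∫⁻ x, g x = ∑' m : ℤ, ∫⁻ x in Set.Ioc (m : ℝ) (m + 1), g x := by
    intro g
    rw [← lintegral_iUnion (fun _ => measurableSet_Ioc) (Set.pairwise_disjoint_Ioc_intCast ℝ),
      iUnion_Ioc_intCast, setLIntegral_univ]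
  have hcell : ∀ m : ℤ, ∫⁻ x in Set.Ioc (m : ℝ) (m + 1),
      ENNReal.ofReal (‖trigPoly M a (d * x)‖ ^ 2 * W x) ≤
      ENNReal.ofReal (16 * S) * ∫⁻ x in Set.Ioc (m : ℝ) (m + 1), ENNReal.ofReal (W x) := by
    intro m
    have hdist : ∀ x ∈ Set.Ioc (m : ℝ) (m + 1), |x - m| ≤ 1 := fun x hx => by
      rw [abs_le]
      constructor <;> linarith [hx.1, hx.2]
    have h1 : ∫⁻ x in Set.Ioc (m : ℝ) (m + 1),
        ENNReal.ofReal (‖trigPoly M a (d * x)‖ ^ 2 * W x) ≤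
        ENNReal.ofReal (4 * W m * S) := by
      have h2 : ∫⁻ x in Set.Ioc (m : ℝ) (m + 1), ENNReal.ofReal (‖trigPoly M a (d * x)‖ ^ 2)
          = ENNReal.ofReal S := by
        rw [hS, ← integral_norm_sq_trigPoly hd M a m,
          intervalIntegral.integral_of_le (by linarith), ofReal_integral_eq_lintegral_ofReal]
        · have hc : Continuous fun x : ℝ => ‖trigPoly M a (d * x)‖ ^ 2 :=
            (((continuous_trigPoly M a).comp (continuous_const.mul continuous_id)).norm).pow 2
          exact (hc.intervalIntegrable _ _).1
        · exact Filter.Eventually.of_forall fun x => by positivity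
      rw [ENNReal.ofReal_mul (by have := hW0 m; positivity), ← h2,
        ← lintegral_const_mul' _ _ ENNReal.ofReal_ne_top]
      refine setLIntegral_mono' measurableSet_Ioc fun x hx => ?_
      rw [← ENNReal.ofReal_mul (by have := hW0 m; positivity)]
      refine ENNReal.ofReal_le_ofReal ?_
      rw [mul_comm]
      exact mul_le_mul_of_nonneg_right (decay_le_of_dist_le_one hr hr1 (hdist x hx))
        (by positivity)
    have h3 : ENNReal.ofReal (W m) ≤
        4 * ∫⁻ x in Set.Ioc (m : ℝ) (m + 1), ENNReal.ofReal (W x) := by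
      have h4 : ENNReal.ofReal (W m) = ∫⁻ x in Set.Ioc (m : ℝ) (m + 1), ENNReal.ofReal (W m) := by
        simp
      rw [h4, ← lintegral_const_mul' _ _ (by simp)]
      refine setLIntegral_mono' measurableSet_Ioc fun x hx => ?_
      rw [← ENNReal.ofReal_ofNat 4, ← ENNReal.ofReal_mul (by norm_num)]
      refine ENNReal.ofReal_le_ofReal (decay_le_of_dist_le_one hr hr1 ?_)
      rw [abs_sub_comm]
      exact hdist x hx
    refine h1.trans ?_
    calc ENNReal.ofReal (4 * W m * S) = ENNReal.ofReal (4 * S) * ENNReal.ofReal (W m) := by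
          rw [← ENNReal.ofReal_mul (by positivity)]
          congr 1
          ring
      _ ≤ ENNReal.ofReal (4 * S) * (4 * ∫⁻ x in Set.Ioc (m : ℝ) (m + 1), ENNReal.ofReal (W x)) := by
          gcongr
      _ = _ := by
          rw [← mul_assoc, ← ENNReal.ofReal_ofNat 4, ← ENNReal.ofReal_mul (by positivity)]
          congr 2
          ring
  calc _ ≤ ∑' m : ℤ, ENNReal.ofReal (16 * S) *
        ∫⁻ x in Set.Ioc (m : ℝ) (m + 1), ENNReal.ofReal (W x) := by
        rw [hsplit]
        exact ENNReal.tsum_le_tsum hcell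
    _ = ENNReal.ofReal (16 * decayMass / r * S) := by
        rw [ENNReal.tsum_mul_left, ← hsplit, lintegral_decay hr,
          ← ENNReal.ofReal_mul (by positivity)]
        congr 1
        ring

/-- Normalised flat coefficients: a square of a Dirichlet kernel has small `L¹` norm, and no large
coefficients, compared to its `L²` norm. -/
theorem exists_flat_coefficients {N : ℕ} (hN : N ≠ 0) :
    ∃ a : ℕ → ℝ, ∃ b : ℕ → ℂ,
      ∑ m ∈ Finset.range (2 * N), a m ^ 2 = 1 ∧
      (∀ m, 0 ≤ a m ∧ a m ≤ √(2 / N)) ∧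
      (∀ y, ‖trigPoly (2 * N) (fun m => (a m : ℂ)) y‖ = ‖trigPoly N b y‖ ^ 2) ∧
      ∑ m ∈ Finset.range N, ‖b m‖ ^ 2 ≤ √(2 / N) := by
  classical
  have hN0 : (0 : ℝ) < N := by exact_mod_cast Nat.pos_of_ne_zero hN
  set T := Finset.range N ×ˢ Finset.range N with hT
  -- The number of representations of m as a sum of two elements of {0, …, N-1}: the coefficients of
  -- the squared Dirichlet sum.
  set c : ℕ → ℕ := fun m => (T.filter fun p => p.1 + p.2 = m).card with hc
  have hmaps : ∀ p ∈ T, p.1 + p.2 ∈ Finset.range (2 * N) := by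
    intro p hp
    simp only [hT, Finset.mem_product, Finset.mem_range] at hp ⊢
    omega
  have hsum : ∑ m ∈ Finset.range (2 * N), c m = N ^ 2 := by
    rw [← Finset.card_eq_sum_card_fiberwise hmaps]
    simp [hT, sq]
  have hle : ∀ m, c m ≤ N := by
    intro m
    calc c m ≤ (Finset.range N).card := by
          refine Finset.card_le_card_of_injOn Prod.fst ?_ ?_
          · intro p hp
            simp only [hT, Finset.coe_filter, Finset.mem_product, Finset.mem_range,
              Set.mem_ofPred_eq] at hp
            simpa using hp.1.1
          · intro p hp p' hp' h
            simp only [Finset.coe_filter, Set.mem_ofPred_eq] at hp hp'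
            ext
            · exact h
            · omega
      _ = N := Finset.card_range N
  set Z : ℝ := ∑ m ∈ Finset.range (2 * N), (c m : ℝ) ^ 2 with hZ
  -- Cauchy–Schwarz over 2N indices: N⁴ = (∑ c)² ≤ 2N · Z.
  have hZle : (N : ℝ) ^ 3 ≤ 2 * Z := by
    have h1 := sq_sum_le_card_mul_sum_sq (s := Finset.range (2 * N)) (f := fun m => (c m : ℝ))
    have h2 : ∑ m ∈ Finset.range (2 * N), (c m : ℝ) = (N : ℝ) ^ 2 := by exact_mod_cast hsum
    rw [h2, Finset.card_range, ← hZ] at h1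
    push_cast at h1
    nlinarith
  have hZ0 : 0 < Z := by
    have : (0 : ℝ) < (N : ℝ) ^ 3 := by positivity
    linarith
  clear_value Z
  have hNZ : (N : ℝ) / √Z ≤ √(2 / N) := by
    rw [div_le_iff₀ (by positivity), ← Real.sqrt_mul (by positivity)]
    refine Real.le_sqrt_of_sq_le ?_
    rw [div_mul_eq_mul_div, le_div_iff₀ hN0]
    nlinarith
  -- The constant Z^{-1/4} makes the square of the second polynomial equal in modulus to the first;
  -- its coefficients have square sum N/√Z, which also bounds every c m / √Z.
  refine ⟨fun m => c m / √Z, fun _ => ((√(√Z))⁻¹ : ℝ), ?_, fun m => ⟨by positivity, ?_⟩, ?_, ?_⟩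
  · simp only [div_pow, Real.sq_sqrt hZ0.le]
    rw [← Finset.sum_div, ← hZ, div_self hZ0.ne']
  · refine le_trans ?_ hNZ
    exact div_le_div_of_nonneg_right (by exact_mod_cast hle m) (Real.sqrt_nonneg _)
  · intro y
    set e : ℕ → ℂ := fun m => Complex.exp (2 * Real.pi * Complex.I * m * y) with he
    have h1 : trigPoly (2 * N) (fun m => ((c m / √Z : ℝ) : ℂ)) y =
        ((√Z : ℝ) : ℂ)⁻¹ * (∑ m ∈ Finset.range N, e m) ^ 2 := by
      have h2 : (∑ m ∈ Finset.range N, e m) ^ 2 = ∑ m ∈ Finset.range (2 * N), (c m : ℂ) * e m := by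
        rw [sq, Finset.sum_mul_sum, ← Finset.sum_product', ← Finset.sum_fiberwise_of_maps_to hmaps]
        refine Finset.sum_congr rfl fun m _ => ?_
        rw [Finset.sum_congr rfl (g := fun _ => e m), Finset.sum_const, nsmul_eq_mul]
        intro p hp
        rw [Finset.mem_filter] at hp
        rw [he, ← hp.2]
        simp only
        rw [← Complex.exp_add]
        congr 1
        push_cast
        ring
      rw [h2, trigPoly, Finset.mul_sum]
      refine Finset.sum_congr rfl fun m _ => ?_
      push_cast
      ring
    have h3 : trigPoly N (fun _ => (((√(√Z))⁻¹ : ℝ) : ℂ)) y =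
        (((√(√Z))⁻¹ : ℝ) : ℂ) * ∑ m ∈ Finset.range N, e m := by
      rw [trigPoly, Finset.mul_sum]
    rw [h1, h3, norm_mul, norm_mul, norm_pow, mul_pow, norm_inv, Complex.norm_real,
      Complex.norm_real, Real.norm_of_nonneg (by positivity), Real.norm_of_nonneg (by positivity),
      inv_pow, Real.sq_sqrt (by positivity)]
  · rw [Finset.sum_const, Finset.card_range, nsmul_eq_mul, Complex.norm_real,
      Real.norm_of_nonneg (by positivity), inv_pow, Real.sq_sqrt (by positivity),
      ← div_eq_mul_inv]
    exact hNZ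

end TrigonometricPolynomials

end ShiftInvariant

/-! ### Smooth bumps whose squares sum to 1 on the open unit interval. -/

namespace ShiftInvariant

section Profiles

open scoped ContDiff

/-- A smooth angle rising from `0` on `(-∞, 1]` to `π / 2` on `[2, ∞)`. -/
noncomputable def stepAngle (x : ℝ) : ℝ := Real.pi / 2 * Real.smoothTransition (x - 1)

theorem contDiff_stepAngle : ContDiff ℝ ∞ stepAngle := by
  have h : ContDiff ℝ ∞ Real.smoothTransition := Real.smoothTransition.contDiff
  unfold stepAngle
  fun_prop

theorem stepAngle_of_le_one {x : ℝ} (hx : x ≤ 1) : stepAngle x = 0 := by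
  rw [stepAngle, Real.smoothTransition.zero_of_nonpos (by linarith), mul_zero]

theorem stepAngle_of_two_le {x : ℝ} (hx : 2 ≤ x) : stepAngle x = Real.pi / 2 := by
  rw [stepAngle, Real.smoothTransition.one_of_one_le (by linarith), mul_one]

theorem stepAngle_three_sub (x : ℝ) : stepAngle (3 - x) = Real.pi / 2 - stepAngle x := by
  have h : Real.smoothTransition (1 - (x - 1)) = 1 - Real.smoothTransition (x - 1) := by
    have h0 := (Real.smoothTransition.pos_denom (x - 1)).ne'
    have h1 := (Real.smoothTransition.pos_denom (1 - (x - 1))).ne'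
    unfold Real.smoothTransition
    rw [sub_sub_cancel] at h1 ⊢
    field_simp
    ring
  rw [stepAngle, stepAngle, show 3 - x - 1 = 1 - (x - 1) by ring, h]
  ring

/-- A smooth bump living on `[ρ, 2]`. -/
noncomputable def ringBump (ρ x : ℝ) : ℝ := Real.sin (stepAngle (x / ρ)) * Real.cos (stepAngle x)

theorem contDiff_ringBump (ρ : ℝ) : ContDiff ℝ ∞ (ringBump ρ) := by
  have h := contDiff_stepAngle
  unfold ringBump
  have h1 : ContDiff ℝ ∞ fun x : ℝ => stepAngle (x / ρ) := h.comp (contDiff_id.div_const ρ)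
  exact h1.sin.mul h.cos

theorem abs_ringBump_le_one (ρ x : ℝ) : |ringBump ρ x| ≤ 1 := by
  rw [ringBump, abs_mul]
  exact mul_le_one₀ (Real.abs_sin_le_one _) (abs_nonneg _) (Real.abs_cos_le_one _)

theorem of_ringBump_ne_zero {ρ x : ℝ} (hρ : 0 < ρ) (h : ringBump ρ x ≠ 0) : 0 < x ∧ x < 2 := by
  constructor
  · by_contra! hx
    refine h ?_
    rw [ringBump, stepAngle_of_le_one, Real.sin_zero, zero_mul]
    exact (div_nonpos_of_nonpos_of_nonneg hx hρ.le).trans zero_le_one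
  · by_contra! hx
    refine h ?_
    rw [ringBump, stepAngle_of_two_le hx, Real.cos_pi_div_two, mul_zero]

theorem hasCompactSupport_ringBump {ρ : ℝ} (hρ : 0 < ρ) : HasCompactSupport (ringBump ρ) := by
  refine HasCompactSupport.of_support_subset_isCompact (isCompact_Icc (a := 0) (b := 2)) ?_
  intro x hx
  have := of_ringBump_ne_zero hρ hx
  exact ⟨this.1.le, this.2.le⟩

/-- As ρ ≤ 1/2, the transitions on [ρ, 2ρ] and [1, 2] do not overlap in their interiors. The product
thus becomes a difference, which telescopes under x ↦ x/ρ. -/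
theorem sq_ringBump {ρ x : ℝ} (hρ : 0 < ρ) (hρ2 : ρ ≤ 1 / 2) :
    ringBump ρ x ^ 2 = Real.sin (stepAngle (x / ρ)) ^ 2 - Real.sin (stepAngle x) ^ 2 := by
  rw [ringBump, mul_pow, Real.cos_sq']
  rcases le_or_gt x 1 with h | h
  · rw [stepAngle_of_le_one h]
    simp
  · rw [stepAngle_of_two_le (x := x / ρ)]
    · simp
    · rw [le_div_iff₀ hρ]
      linarith

theorem hasSum_sq_ringBump {ρ x : ℝ} (hρ : 0 < ρ) (hρ2 : ρ ≤ 1 / 2) (hx : 0 < x) :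
    HasSum (fun j : ℕ => ringBump ρ (x / ρ ^ j) ^ 2) (Real.cos (stepAngle x) ^ 2) := by
  rw [hasSum_iff_tendsto_nat_of_nonneg (fun _ => by positivity)]
  have hpart : ∀ J : ℕ, ∑ j ∈ Finset.range J, ringBump ρ (x / ρ ^ j) ^ 2 =
      Real.sin (stepAngle (x / ρ ^ J)) ^ 2 - Real.sin (stepAngle x) ^ 2 := by
    intro J
    have := Finset.sum_range_sub (fun j : ℕ => Real.sin (stepAngle (x / ρ ^ j)) ^ 2) J
    rw [pow_zero, div_one] at this
    rw [← this]
    refine Finset.sum_congr rfl fun j _ => ?_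
    rw [sq_ringBump hρ hρ2, div_div, ← pow_succ]
  have hev : ∀ᶠ J : ℕ in Filter.atTop, ρ ^ J < x / 2 :=
    (tendsto_pow_atTop_nhds_zero_of_lt_one hρ.le (by linarith)).eventually_lt_const (by linarith)
  refine tendsto_const_nhds.congr' ?_
  filter_upwards [hev] with J hJ
  rw [hpart, stepAngle_of_two_le (x := x / ρ ^ J), Real.sin_pi_div_two, Real.cos_sq']
  · ring
  · rw [le_div_iff₀ (by positivity)]
    linarith

/-- The identity or the reflection of the unit interval. -/
noncomputable def flipUnit (b : Bool) (s : ℝ) : ℝ := if b then 1 - s else s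

/-- The rescaled bump at distance about `r` from one end of the unit interval. -/
noncomputable def endBump (ρ : ℝ) (b : Bool) (r s : ℝ) : ℝ := ringBump ρ (flipUnit b s / r)

theorem contDiff_endBump (ρ : ℝ) (b : Bool) (r : ℝ) : ContDiff ℝ ∞ (endBump ρ b r) := by
  have h : ContDiff ℝ ∞ fun s : ℝ => flipUnit b s / r := by
    unfold flipUnit
    cases b <;> simp <;> fun_prop
  exact (contDiff_ringBump ρ).comp h

theorem abs_endBump_le_one (ρ : ℝ) (b : Bool) (r s : ℝ) : |endBump ρ b r s| ≤ 1 :=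
  abs_ringBump_le_one _ _

/-- The interval of length `2 * r` at one end of the unit interval. -/
noncomputable def endInterval (b : Bool) (r : ℝ) : Set ℝ :=
  if b then Set.Ioo (1 - 2 * r) 1 else Set.Ioo 0 (2 * r)

theorem volume_endInterval (b : Bool) (r : ℝ) :
    volume (endInterval b r) = ENNReal.ofReal (2 * r) := by
  cases b <;> simp [endInterval, Real.volume_Ioo]

theorem measurableSet_endInterval (b : Bool) (r : ℝ) : MeasurableSet (endInterval b r) := by
  cases b <;> simp [endInterval]

theorem endInterval_subset {b : Bool} {r : ℝ} (hr : r ≤ 1 / 3) :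
    endInterval b r ⊆ Set.Ioo 0 1 := by
  cases b
  · exact fun s hs => ⟨hs.1, hs.2.trans_le (by linarith)⟩
  · exact fun s hs => ⟨by linarith [hs.1], hs.2⟩

theorem support_endBump_subset {ρ : ℝ} (hρ : 0 < ρ) (b : Bool) {r : ℝ} (hr : 0 < r) :
    Function.support (endBump ρ b r) ⊆ endInterval b r := by
  intro s hs
  have h := of_ringBump_ne_zero hρ hs
  rw [div_pos_iff_of_pos_right hr, div_lt_iff₀ hr] at h
  cases b
  · exact h
  · have h' : 0 < 1 - s ∧ 1 - s < 2 * r := h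
    exact ⟨by linarith, by linarith⟩

/-- Each end telescopes to a cos². The starting scale 1/3 turns s and 1 - s into 3s and 3 - 3s,
which the symmetry of `stepAngle` about 3/2 exchanges, so the two ends add up to cos² + sin². -/
theorem hasSum_sq_endBump {ρ s : ℝ} (hρ : 0 < ρ) (hρ2 : ρ ≤ 1 / 2) (hs : s ∈ Set.Ioo (0 : ℝ) 1) :
    HasSum (fun i : Bool × ℕ => endBump ρ i.1 (ρ ^ i.2 / 3) s ^ 2) 1 := by
  have h0 := hasSum_sq_ringBump hρ hρ2 (x := 3 * s) (by linarith [hs.1])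
  have h1 := hasSum_sq_ringBump hρ hρ2 (x := 3 - 3 * s) (by linarith [hs.2])
  have e : Real.cos (stepAngle (3 * s)) ^ 2 + Real.cos (stepAngle (3 - 3 * s)) ^ 2 = 1 := by
    rw [stepAngle_three_sub, Real.cos_pi_div_two_sub, Real.cos_sq_add_sin_sq]
  rw [← e]
  refine HasSum.bool_prod ?_ ?_
  · convert h0 using 4 with j
    simp only [endBump, flipUnit, Bool.false_eq_true, if_false]
    congr 1
    field_simp
  · convert h1 using 4 with j
    simp only [endBump, flipUnit, if_true]
    congr 1
    field_simp

/-- The inverse Fourier transform of the basic bump. -/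
noncomputable def ringWave (ρ x : ℝ) : ℂ :=
  ∫ ξ : ℝ, Complex.exp (2 * Real.pi * Complex.I * x * ξ) * (ringBump ρ ξ : ℂ)

theorem exists_ringWave_decay {ρ : ℝ} (hρ : 0 < ρ) (K : ℝ) :
    ∃ C : ℝ, 0 ≤ C ∧ ∀ x, ‖ringWave ρ x‖ ≤ C * (1 + |x|) ^ (-K) := by
  have hc : HasCompactSupport fun x => (ringBump ρ x : ℂ) :=
    (hasCompactSupport_ringBump hρ).comp_left Complex.ofReal_zero
  have hs : ContDiff ℝ ∞ fun x => (ringBump ρ x : ℂ) :=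
    Complex.ofRealCLM.contDiff.comp (contDiff_ringBump ρ)
  set η : SchwartzMap ℝ ℂ := hc.toSchwartzMap hs
  have hη : ∀ x, (𝓕⁻ η) x = ringWave ρ x := by
    intro x
    rw [SchwartzMap.fourierInv_coe, fourierInv_real_apply]
    rfl
  obtain ⟨k, hk⟩ := exists_nat_ge K
  have h := SchwartzMap.one_add_le_sup_seminorm_apply (𝕜 := ℝ) (m := (k, 0)) le_rfl le_rfl (𝓕⁻ η)
  set C := 2 ^ k * ((Finset.Iic (k, 0)).sup fun m => SchwartzMap.seminorm ℝ m.1 m.2) (𝓕⁻ η)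
  have hC : ∀ x, (1 + |x|) ^ k * ‖ringWave ρ x‖ ≤ C := by
    intro x
    have := h x
    rw [norm_iteratedFDeriv_zero, hη] at this
    exact this
  refine ⟨C, (by positivity : (0 : ℝ) ≤ (1 + |(0 : ℝ)|) ^ k * ‖ringWave ρ 0‖).trans (hC 0),
    fun x => ?_⟩
  have h1 : (0 : ℝ) < 1 + |x| := by positivity
  rw [Real.rpow_neg h1.le, ← div_eq_mul_inv, le_div_iff₀ (by positivity), mul_comm]
  refine le_trans ?_ (hC x)
  gcongr
  rw [← Real.rpow_natCast]
  exact Real.rpow_le_rpow_of_exponent_le (by linarith [abs_nonneg x]) hk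

/-- Here y = ±rx: reflecting the unit interval changes the sign of x and adds a unimodular factor.
Only |y| enters the decay bounds. -/
theorem norm_integral_exp_mul_endBump (ρ : ℝ) (b : Bool) {r : ℝ} (hr : 0 < r) (x : ℝ) :
    ∃ y : ℝ, |y| = r * |x| ∧
      ‖∫ s : ℝ, Complex.exp (2 * Real.pi * Complex.I * x * s) * (endBump ρ b r s : ℂ)‖ =
        r * ‖ringWave ρ y‖ := by
  have key : ∀ y : ℝ, ∫ s : ℝ, Complex.exp (2 * Real.pi * Complex.I * y * s) *
      (ringBump ρ (s / r) : ℂ) = r * ringWave ρ (r * y) := by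
    intro y
    have := Measure.integral_comp_div (fun ξ : ℝ =>
      Complex.exp (2 * Real.pi * Complex.I * (r * y : ℝ) * ξ) * (ringBump ρ ξ : ℂ)) r
    rw [abs_of_pos hr, Complex.real_smul] at this
    rw [ringWave, ← this]
    refine integral_congr_ae (Filter.Eventually.of_forall fun s => ?_)
    have : (r : ℂ) ≠ 0 := by exact_mod_cast hr.ne'
    simp only
    congr 2
    push_cast
    field_simp
  cases b
  · refine ⟨r * x, by rw [abs_mul, abs_of_pos hr], ?_⟩
    simp only [endBump, flipUnit, Bool.false_eq_true, if_false, key, norm_mul, Complex.norm_real,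
      Real.norm_of_nonneg hr.le]
  · refine ⟨r * (-x), by rw [abs_mul, abs_of_pos hr, abs_neg], ?_⟩
    simp only [endBump, flipUnit, if_true]
    rw [← integral_sub_left_eq_self _ volume 1]
    have : ∀ s : ℝ, Complex.exp (2 * Real.pi * Complex.I * x * (1 - s : ℝ)) *
        (ringBump ρ ((1 - (1 - s)) / r) : ℂ) = Complex.exp ((2 * Real.pi * x : ℝ) * Complex.I) *
        (Complex.exp (2 * Real.pi * Complex.I * (-x : ℝ) * s) * (ringBump ρ (s / r) : ℂ)) := by
      intro s
      rw [← mul_assoc, ← Complex.exp_add, sub_sub_cancel]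
      congr 2
      push_cast
      ring
    simp only [this]
    rw [integral_const_mul, key, norm_mul, Complex.norm_exp_ofReal_mul_I, one_mul, norm_mul,
      Complex.norm_real, Real.norm_of_nonneg hr.le]

end Profiles

end ShiftInvariant

/-! ### Pieces: one end bump copied into many cells. -/

theorem norm_sq_sum_of_disjoint {ι E : Type*} [NormedAddCommGroup E] (s : Finset ι) (f : ι → E)
    (h : ∀ i ∈ s, ∀ j ∈ s, i ≠ j → f i = 0 ∨ f j = 0) :
    ‖∑ i ∈ s, f i‖ ^ 2 = ∑ i ∈ s, ‖f i‖ ^ 2 := by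
  by_cases hz : ∀ i ∈ s, f i = 0
  · rw [Finset.sum_eq_zero hz, Finset.sum_eq_zero fun i hi => by simp [hz i hi]]
    simp
  · push Not at hz
    obtain ⟨i, hi, hne⟩ := hz
    have h0 : ∀ j ∈ s, j ≠ i → f j = 0 := fun j hj hji =>
      (h i hi j hj hji.symm).resolve_left hne
    rw [Finset.sum_eq_single_of_mem i hi h0,
      Finset.sum_eq_single_of_mem i hi fun j hj hji => by simp [h0 j hj hji]]

namespace ShiftInvariant

section Pieces

open scoped ContDiff

/-- The position of the `m`-th cell in the block belonging to `N` and `b`. -/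
def cellIndex (N : ℕ) (b : Bool) (m : ℕ) : ℕ := 4 * N + 2 * m + b.toNat

theorem cellIndex_inj {N : ℕ} {b b' : Bool} {m m' : ℕ}
    (h : cellIndex N b m = cellIndex N b' m') : b = b' ∧ m = m' := by
  unfold cellIndex at h
  cases b <;> cases b' <;> simp at h ⊢ <;> omega

theorem cellIndex_bounds {N : ℕ} {b : Bool} {m : ℕ} (hm : m < 2 * N) :
    4 * N ≤ cellIndex N b m ∧ cellIndex N b m < 8 * N := by
  unfold cellIndex
  cases b <;> simp <;> omega

/-- Parity separates the two ends inside one block, and the blocks [4N, 8N) for N = L^j are disjoint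
because L ≥ 2. -/
theorem cellIndex_pow_inj {L : ℕ} (hL : 2 ≤ L) {i i' : Bool × ℕ} {m m' : ℕ}
    (hm : m < 2 * L ^ i.2) (hm' : m' < 2 * L ^ i'.2)
    (h : cellIndex (L ^ i.2) i.1 m = cellIndex (L ^ i'.2) i'.1 m') : i = i' := by
  have key : ∀ {i i' : Bool × ℕ} {m m' : ℕ}, m < 2 * L ^ i.2 → i.2 < i'.2 →
      cellIndex (L ^ i.2) i.1 m = cellIndex (L ^ i'.2) i'.1 m' → False := by
    intro i i' m m' hm hlt h
    have h1 := (cellIndex_bounds (b := i.1) hm).2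
    have h2 : 4 * L ^ i'.2 ≤ cellIndex (L ^ i'.2) i'.1 m' := by
      unfold cellIndex
      omega
    have h3 : 2 * L ^ i.2 ≤ L ^ i'.2 := by
      calc 2 * L ^ i.2 ≤ L * L ^ i.2 := Nat.mul_le_mul_right _ hL
        _ = L ^ (i.2 + 1) := by rw [pow_succ, mul_comm]
        _ ≤ L ^ i'.2 := Nat.pow_le_pow_right (by omega) hlt
    omega
  rcases lt_trichotomy i.2 i'.2 with hlt | heq | hgt
  · exact (key hm hlt h).elim
  · rw [heq] at h
    exact Prod.ext (cellIndex_inj h).1 heq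
  · exact (key hm' hgt h.symm).elim

/-- Copies of one end bump, with amplitudes `a m`, in the cells of one block. -/
noncomputable def piece (ρ : ℝ) (n N : ℕ) (b : Bool) (r : ℝ) (a : ℕ → ℝ) (ξ : ℝ) : ℂ :=
  ∑ m ∈ Finset.range (2 * N), (a m : ℂ) * (endBump ρ b r (ξ - n * cellIndex N b m) : ℂ)

theorem contDiff_piece (ρ : ℝ) (n N : ℕ) (b : Bool) (r : ℝ) (a : ℕ → ℝ) :
    ContDiff ℝ ∞ (piece ρ n N b r a) := by
  unfold piece
  refine ContDiff.sum fun m _ => contDiff_const.mul ?_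
  exact Complex.ofRealCLM.contDiff.comp
    ((contDiff_endBump ρ b r).comp (contDiff_id.sub contDiff_const))

variable {ρ : ℝ} (hρ : 0 < ρ) {n N : ℕ} (hn : n ≠ 0) {b : Bool} {r : ℝ} (hr : 0 < r)
  (hr3 : r ≤ 1 / 3) {a : ℕ → ℝ}

include hρ hr hr3

theorem mem_Ioo_of_endBump_ne_zero {s : ℝ} (h : endBump ρ b r s ≠ 0) : s ∈ Set.Ioo (0 : ℝ) 1 :=
  endInterval_subset hr3 (support_endBump_subset hρ b hr h)

theorem hasCompactSupport_piece : HasCompactSupport (piece ρ n N b r a) := by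
  refine HasCompactSupport.of_support_subset_isCompact
    (isCompact_Icc (a := (0 : ℝ)) (b := n * (8 * N) + 1)) ?_
  intro ξ hξ
  obtain ⟨m, hm, hne⟩ := Finset.exists_ne_zero_of_sum_ne_zero hξ
  have h1 : endBump ρ b r (ξ - n * cellIndex N b m) ≠ 0 := by
    intro h0
    simp [h0] at hne
  have h2 := mem_Ioo_of_endBump_ne_zero hρ hr hr3 h1
  have h3 := (cellIndex_bounds (b := b) (Finset.mem_range.1 hm)).2
  have h4 : (cellIndex N b m : ℝ) ≤ 8 * N := by exact_mod_cast h3.le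
  have h5 : (n : ℝ) * cellIndex N b m ≤ n * (8 * N) := by gcongr
  have h6 : (0 : ℝ) ≤ (n : ℝ) * cellIndex N b m := by positivity
  exact ⟨by linarith [h2.1], by linarith [h2.2]⟩

include hn

omit hρ hr hr3 in
theorem cell_eq_of_mem_Ioo {k k' : ℕ} {ξ : ℝ} (h : ξ - n * k ∈ Set.Ioo (0 : ℝ) 1)
    (h' : ξ - n * k' ∈ Set.Ioo (0 : ℝ) 1) : k = k' := by
  have hn1 : 1 ≤ n := Nat.one_le_iff_ne_zero.2 hn
  have key : ∀ {k k' : ℕ}, ξ - n * k ∈ Set.Ioo (0 : ℝ) 1 → ξ - n * k' ∈ Set.Ioo (0 : ℝ) 1 →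
      ¬ k < k' := by
    intro k k' h h' hlt
    have h1 : (k : ℝ) + 1 ≤ k' := by exact_mod_cast hlt
    have h2 : (1 : ℝ) ≤ n := by exact_mod_cast hn1
    nlinarith [h.2, h'.1]
  have h1 := key h h'
  have h2 := key h' h
  omega

theorem norm_sq_piece (ξ : ℝ) :
    ‖piece ρ n N b r a ξ‖ ^ 2 = ∑ m ∈ Finset.range (2 * N),
      a m ^ 2 * endBump ρ b r (ξ - n * cellIndex N b m) ^ 2 := by
  rw [piece, norm_sq_sum_of_disjoint]
  · refine Finset.sum_congr rfl fun m _ => ?_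
    rw [norm_mul, mul_pow, Complex.norm_real, Complex.norm_real, Real.norm_eq_abs,
      Real.norm_eq_abs, sq_abs, sq_abs]
  · intro m _ m' _ hne
    by_contra! h
    have h1 : endBump ρ b r (ξ - n * cellIndex N b m) ≠ 0 := by
      intro h0
      simp [h0] at h
    have h2 : endBump ρ b r (ξ - n * cellIndex N b m') ≠ 0 := by
      intro h0
      simp [h0] at h
    exact hne (cellIndex_inj (cell_eq_of_mem_Ioo hn
      (mem_Ioo_of_endBump_ne_zero hρ hr hr3 h1) (mem_Ioo_of_endBump_ne_zero hρ hr hr3 h2))).2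

theorem exists_cell_of_piece_ne_zero {ξ : ℝ} (h : piece ρ n N b r a ξ ≠ 0) :
    ∃ m < 2 * N, ξ - n * cellIndex N b m ∈ endInterval b r ∧
      ‖piece ρ n N b r a ξ‖ ≤ |a m| := by
  obtain ⟨m, hm, hne⟩ := Finset.exists_ne_zero_of_sum_ne_zero h
  have h1 : endBump ρ b r (ξ - n * cellIndex N b m) ≠ 0 := by
    intro h0
    simp [h0] at hne
  refine ⟨m, Finset.mem_range.1 hm, support_endBump_subset hρ b hr h1, ?_⟩
  have h2 : piece ρ n N b r a ξ = (a m : ℂ) * (endBump ρ b r (ξ - n * cellIndex N b m) : ℂ) := by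
    refine Finset.sum_eq_single_of_mem m hm fun m' _ hne' => ?_
    by_contra h0
    have h3 : endBump ρ b r (ξ - n * cellIndex N b m') ≠ 0 := by
      intro h0'
      simp [h0'] at h0
    exact hne' (cellIndex_inj (cell_eq_of_mem_Ioo hn
      (mem_Ioo_of_endBump_ne_zero hρ hr hr3 h3) (mem_Ioo_of_endBump_ne_zero hρ hr hr3 h1))).2
  rw [h2, norm_mul, Complex.norm_real, Complex.norm_real, Real.norm_eq_abs, Real.norm_eq_abs]
  exact mul_le_of_le_one_right (abs_nonneg _) (abs_endBump_le_one _ _ _ _)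

theorem piece_disjoint {N' : ℕ} {b' : Bool} {r' : ℝ} (hr' : 0 < r') (hr3' : r' ≤ 1 / 3)
    {a' : ℕ → ℝ} (hne : ∀ m m', m < 2 * N → m' < 2 * N' → cellIndex N b m ≠ cellIndex N' b' m')
    (ξ : ℝ) : piece ρ n N b r a ξ = 0 ∨ piece ρ n N' b' r' a' ξ = 0 := by
  by_contra! h
  obtain ⟨m, hm, h1, -⟩ := exists_cell_of_piece_ne_zero hρ hn hr hr3 h.1
  obtain ⟨m', hm', h2, -⟩ := exists_cell_of_piece_ne_zero hρ hn hr' hr3' h.2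
  exact hne m m' hm hm'
    (cell_eq_of_mem_Ioo hn (endInterval_subset hr3 h1) (endInterval_subset hr3' h2))

/-- The cells start at multiples of n and the character has period n, so every copy gives the same
integral, weighted by a m ^ 2; the weights sum to 1. -/
theorem integral_exp_mul_norm_sq_piece (ha : ∑ m ∈ Finset.range (2 * N), a m ^ 2 = 1) (k : ℤ) :
    ∫ ξ : ℝ, Complex.exp (2 * Real.pi * Complex.I * (-((k : ℝ) / n) : ℝ) * ξ) *
      ((‖piece ρ n N b r a ξ‖ ^ 2 : ℝ) : ℂ) =
    ∫ s in (0 : ℝ)..1, Complex.exp (2 * Real.pi * Complex.I * (-((k : ℝ) / n) : ℝ) * s) *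
      ((endBump ρ b r s ^ 2 : ℝ) : ℂ) := by
  set e : ℝ → ℂ := fun ξ => Complex.exp (2 * Real.pi * Complex.I * (-((k : ℝ) / n) : ℝ) * ξ)
    with he
  set g : ℝ → ℂ := fun s => e s * ((endBump ρ b r s ^ 2 : ℝ) : ℂ) with hg
  have hn' : (n : ℂ) ≠ 0 := by exact_mod_cast hn
  have hper : ∀ (l : ℕ) (ξ : ℝ), e (ξ - n * l) = e ξ := by
    intro l ξ
    simp only [he]
    rw [Complex.exp_eq_exp_iff_exists_int]
    refine ⟨k * l, ?_⟩
    push_cast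
    field_simp
    ring
  have hsupp : Function.support g ⊆ Set.Ioc (0 : ℝ) 1 := by
    intro s hs
    have h1 : endBump ρ b r s ≠ 0 := by
      intro h0
      simp [hg, h0] at hs
    exact Set.Ioo_subset_Ioc_self (mem_Ioo_of_endBump_ne_zero hρ hr hr3 h1)
  have hgc : Continuous g := by
    have := (contDiff_endBump ρ b r).continuous
    simp only [hg, he]
    fun_prop
  have hgi : Integrable g := hgc.integrable_of_hasCompactSupport
    (HasCompactSupport.of_support_subset_isCompact isCompact_Icc
      (hsupp.trans Set.Ioc_subset_Icc_self))
  have hexp : ∀ ξ, e ξ * ((‖piece ρ n N b r a ξ‖ ^ 2 : ℝ) : ℂ) =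
      ∑ m ∈ Finset.range (2 * N), ((a m ^ 2 : ℝ) : ℂ) * g (ξ - n * cellIndex N b m) := by
    intro ξ
    rw [norm_sq_piece hρ hn hr hr3, Complex.ofReal_sum, Finset.mul_sum]
    refine Finset.sum_congr rfl fun m _ => ?_
    simp only [hg]
    rw [hper]
    push_cast
    ring
  change ∫ ξ, e ξ * ((‖piece ρ n N b r a ξ‖ ^ 2 : ℝ) : ℂ) = ∫ s in (0 : ℝ)..1, g s
  simp only [hexp]
  rw [integral_finsetSum _ fun m _ => (hgi.comp_sub_right _).const_mul _]
  simp only [integral_const_mul, integral_sub_right_eq_self]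
  rw [← Finset.sum_mul, ← Complex.ofReal_sum, ha, Complex.ofReal_one, one_mul,
    intervalIntegral.integral_eq_integral_of_support_subset hsupp]

/-- The support has measure at most 2N · 2r and lies in |ξ| ≤ 8nN, and the modulus is at most B
since the copies do not overlap. -/
theorem lintegral_piece_le {q δ : ℝ} (hq : 0 < q) (hδ : 0 ≤ δ) {B : ℝ}
    (ha : ∀ m, |a m| ≤ B) :
    ∫⁻ ξ, ENNReal.ofReal (‖piece ρ n N b r a ξ‖ ^ q * (1 + |ξ|) ^ δ) ≤
      ENNReal.ofReal (4 * N * r * (B ^ q * (1 + 8 * n * N) ^ δ)) := by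
  have hB : 0 ≤ B := (abs_nonneg _).trans (ha 0)
  set U : Set ℝ := ⋃ m ∈ Finset.range (2 * N), (fun ξ : ℝ => ξ - n * cellIndex N b m) ⁻¹'
    endInterval b r with hU
  have hUm : MeasurableSet U :=
    Finset.measurableSet_biUnion _ fun m _ =>
      (measurableSet_endInterval b r).preimage (measurable_id.sub_const _)
  have hvol : volume U ≤ ENNReal.ofReal (4 * N * r) := by
    calc volume U ≤ ∑ m ∈ Finset.range (2 * N), volume
          ((fun ξ : ℝ => ξ - n * cellIndex N b m) ⁻¹' endInterval b r) :=
          measure_biUnion_finset_le _ _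
      _ = ∑ m ∈ Finset.range (2 * N), ENNReal.ofReal (2 * r) := by
          refine Finset.sum_congr rfl fun m _ => ?_
          rw [(measurePreserving_sub_right volume _).measure_preimage
            (measurableSet_endInterval b r).nullMeasurableSet, volume_endInterval]
      _ = ENNReal.ofReal (4 * N * r) := by
          rw [Finset.sum_const, Finset.card_range, nsmul_eq_mul, ← ENNReal.ofReal_natCast,
            ← ENNReal.ofReal_mul (by positivity)]
          congr 1
          push_cast
          ring
  have hpt : ∀ ξ, ENNReal.ofReal (‖piece ρ n N b r a ξ‖ ^ q * (1 + |ξ|) ^ δ) ≤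
      U.indicator (fun _ => ENNReal.ofReal (B ^ q * (1 + 8 * n * N) ^ δ)) ξ := by
    intro ξ
    by_cases h0 : piece ρ n N b r a ξ = 0
    · simp [h0, Real.zero_rpow hq.ne']
    · obtain ⟨m, hm, hmem, hle⟩ := exists_cell_of_piece_ne_zero hρ hn hr hr3 h0
      have hξU : ξ ∈ U := by
        simp only [hU, Set.mem_iUnion, Set.mem_preimage]
        exact ⟨m, Finset.mem_range.2 hm, hmem⟩
      rw [Set.indicator_of_mem hξU]
      refine ENNReal.ofReal_le_ofReal ?_
      have h1 := endInterval_subset hr3 hmem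
      have h2 : (cellIndex N b m : ℝ) + 1 ≤ 8 * N := by
        exact_mod_cast (cellIndex_bounds (b := b) hm).2
      have hn1 : (1 : ℝ) ≤ n := by exact_mod_cast Nat.one_le_iff_ne_zero.2 hn
      have h3 : (0 : ℝ) ≤ n * cellIndex N b m := by positivity
      have h4 : |ξ| ≤ 8 * n * N := by
        rw [abs_of_pos (by linarith [h1.1])]
        nlinarith [h1.2]
      gcongr
      exact hle.trans (ha m)
  calc _ ≤ ∫⁻ ξ, U.indicator (fun _ => ENNReal.ofReal (B ^ q * (1 + 8 * n * N) ^ δ)) ξ :=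
        lintegral_mono hpt
    _ = ENNReal.ofReal (B ^ q * (1 + 8 * n * N) ^ δ) * volume U := by
        rw [lintegral_indicator hUm, setLIntegral_const]
    _ ≤ ENNReal.ofReal (B ^ q * (1 + 8 * n * N) ^ δ) * ENNReal.ofReal (4 * N * r) := by gcongr
    _ = _ := by
        rw [← ENNReal.ofReal_mul (by positivity)]
        congr 1
        ring

omit hn in
-- The cells of one block form an arithmetic progression of step 2n, so the phases of the copies add
-- up to a trigonometric polynomial at 2nx.
theorem norm_integral_exp_mul_piece (x : ℝ) :
    ∃ y : ℝ, |y| = r * |x| ∧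
      ‖∫ ξ : ℝ, Complex.exp (2 * Real.pi * Complex.I * x * ξ) * piece ρ n N b r a ξ‖ =
        r * ‖ringWave ρ y‖ * ‖trigPoly (2 * N) (fun m => (a m : ℂ)) ((2 * n : ℕ) * x)‖ := by
  obtain ⟨y, hy, hnorm⟩ := norm_integral_exp_mul_endBump ρ b hr x
  refine ⟨y, hy, ?_⟩
  set g : ℝ → ℂ := fun s => Complex.exp (2 * Real.pi * Complex.I * x * s) *
    (endBump ρ b r s : ℂ) with hg
  have hsupp : Function.support g ⊆ Set.Icc (0 : ℝ) 1 := by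
    intro s hs
    have h1 : endBump ρ b r s ≠ 0 := by
      intro h0
      simp [hg, h0] at hs
    exact Set.Ioo_subset_Icc_self (mem_Ioo_of_endBump_ne_zero hρ hr hr3 h1)
  have hgc : Continuous g := by
    have := (contDiff_endBump ρ b r).continuous
    simp only [hg]
    fun_prop
  have hgi : Integrable g := hgc.integrable_of_hasCompactSupport
    (HasCompactSupport.of_support_subset_isCompact isCompact_Icc hsupp)
  set c : ℂ := Complex.exp ((2 * Real.pi * (n * (4 * N + b.toNat)) * x : ℝ) * Complex.I) with hc
  have hexp : ∀ ξ : ℝ, Complex.exp (2 * Real.pi * Complex.I * x * ξ) * piece ρ n N b r a ξ =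
      ∑ m ∈ Finset.range (2 * N), (c * ((a m : ℂ) * Complex.exp (2 * Real.pi * Complex.I * m *
        (((2 * n : ℕ) * x : ℝ) : ℂ)))) * g (ξ - n * cellIndex N b m) := by
    intro ξ
    rw [piece, Finset.mul_sum]
    refine Finset.sum_congr rfl fun m _ => ?_
    have : Complex.exp (2 * Real.pi * Complex.I * x * ξ) =
        c * Complex.exp (2 * Real.pi * Complex.I * m * (((2 * n : ℕ) * x : ℝ) : ℂ)) *
          Complex.exp (2 * Real.pi * Complex.I * x * (ξ - n * cellIndex N b m : ℝ)) := by
      rw [hc, ← Complex.exp_add, ← Complex.exp_add]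
      congr 1
      unfold cellIndex
      push_cast
      ring
    rw [this]
    simp only [hg]
    ring
  simp only [hexp]
  rw [integral_finsetSum _ fun m _ => (hgi.comp_sub_right _).const_mul _]
  simp only [integral_const_mul, integral_sub_right_eq_self]
  rw [← Finset.sum_mul, ← Finset.mul_sum, norm_mul, norm_mul, hc,
    Complex.norm_exp_ofReal_mul_I, one_mul, hnorm, mul_comm]
  rfl

end Pieces

end ShiftInvariant

/-! ### Estimates for one piece and the choice of scales. -/

namespace ShiftInvariant

section Estimates

theorem one_add_abs_rpow_le {r : ℝ} (hr : 0 < r) (hr1 : r ≤ 1) {s : ℝ} (hs : 0 ≤ s) (x : ℝ) :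
    (1 + |x|) ^ s ≤ r ^ (-s) * (1 + r * |x|) ^ s := by
  rw [Real.rpow_neg hr.le, ← div_eq_inv_mul, le_div_iff₀ (by positivity),
    ← Real.mul_rpow (by positivity) hr.le]
  refine Real.rpow_le_rpow (by positivity) ?_ hs
  nlinarith [abs_nonneg x]

variable {r : ℝ} (hr : 0 < r) (hr1 : r ≤ 1) {d : ℕ} (hd : d ≠ 0) {γ C : ℝ} (hγ : 0 ≤ γ)
  (hC : 0 ≤ C) {F : ℝ → ℂ} {M : ℕ} {a : ℕ → ℂ}
  (hF : ∀ x, ‖F x‖ ≤ C * r * (1 + r * |x|) ^ (-(2 + γ)) * ‖trigPoly M a (d * x)‖)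

include hr hr1 hd hγ hF

/-- Powers of r: 2 from the height of the wave, -s from the weight, -1 from the width. Since s ≤ 1,
the decay left after absorbing the weight is at least (1 + r|x|)^{-2}. -/
theorem lintegral_sq_mul_le (ha : ∑ m ∈ Finset.range M, ‖a m‖ ^ 2 = 1) {s : ℝ} (hs : 0 ≤ s)
    (hs1 : s ≤ 1) :
    ∫⁻ x, ENNReal.ofReal (‖F x‖ ^ (2 : ℝ) * (1 + |x|) ^ s) ≤
      ENNReal.ofReal (16 * decayMass * C ^ 2 * r ^ (1 - s)) := by
  have hpt : ∀ x, ‖F x‖ ^ (2 : ℝ) * (1 + |x|) ^ s ≤ (C ^ 2 * r ^ 2 * r ^ (-s)) *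
      (‖trigPoly M a (d * x)‖ ^ 2 * (1 + r * |x|) ^ (-2 : ℝ)) := by
    intro x
    have hw : 1 ≤ 1 + r * |x| := by have := mul_nonneg hr.le (abs_nonneg x); linarith
    set w := 1 + r * |x| with hwdef
    have hw0 : 0 < w := by linarith
    have h1 : (w ^ (-(2 + γ))) ^ 2 * w ^ s ≤ w ^ (-2 : ℝ) := by
      rw [← Real.rpow_natCast, ← Real.rpow_mul hw0.le, ← Real.rpow_add hw0]
      refine Real.rpow_le_rpow_of_exponent_le hw ?_
      push_cast
      linarith
    rw [Real.rpow_two]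
    calc ‖F x‖ ^ 2 * (1 + |x|) ^ s
        ≤ (C * r * w ^ (-(2 + γ)) * ‖trigPoly M a (d * x)‖) ^ 2 * (r ^ (-s) * w ^ s) := by
          have := hF x
          have := one_add_abs_rpow_le hr hr1 hs x
          gcongr
      _ = (C ^ 2 * r ^ 2 * r ^ (-s)) * (‖trigPoly M a (d * x)‖ ^ 2 *
            ((w ^ (-(2 + γ))) ^ 2 * w ^ s)) := by ring
      _ ≤ _ := by gcongr
  calc _ ≤ ∫⁻ x, ENNReal.ofReal (C ^ 2 * r ^ 2 * r ^ (-s)) *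
        ENNReal.ofReal (‖trigPoly M a (d * x)‖ ^ 2 * (1 + r * |x|) ^ (-2 : ℝ)) := by
        refine lintegral_mono fun x => ?_
        rw [← ENNReal.ofReal_mul (by positivity)]
        exact ENNReal.ofReal_le_ofReal (hpt x)
    _ ≤ ENNReal.ofReal (C ^ 2 * r ^ 2 * r ^ (-s)) * ENNReal.ofReal (16 * decayMass / r * 1) := by
        have h2 := lintegral_trigPoly_mul_decay_le hd M a hr hr1
        rw [ha] at h2
        rw [lintegral_const_mul' _ _ ENNReal.ofReal_ne_top]
        gcongr
    _ = _ := by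
        rw [← ENNReal.ofReal_mul (by positivity), sub_eq_add_neg, Real.rpow_add hr, Real.rpow_one]
        congr 1
        field_simp

include hC

/-- Writing the modulus of the polynomial as a square turns this L¹ bound into a mean-square one,
where the small sum of ‖b m‖ ^ 2 enters. -/
theorem lintegral_norm_mul_le {N : ℕ} {b : ℕ → ℂ} {B : ℝ}
    (hb : ∀ y, ‖trigPoly M a y‖ = ‖trigPoly N b y‖ ^ 2)
    (hB : ∑ m ∈ Finset.range N, ‖b m‖ ^ 2 ≤ B) :
    ∫⁻ x, ENNReal.ofReal (‖F x‖ ^ (1 : ℝ) * (1 + |x|) ^ γ) ≤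
      ENNReal.ofReal (16 * decayMass * C * r ^ (-γ) * B) := by
  have hD := decayMass_nonneg
  have hpt : ∀ x, ‖F x‖ ^ (1 : ℝ) * (1 + |x|) ^ γ ≤ (C * r * r ^ (-γ)) *
      (‖trigPoly N b (d * x)‖ ^ 2 * (1 + r * |x|) ^ (-2 : ℝ)) := by
    intro x
    have hw0 : 0 < 1 + r * |x| := by positivity
    have h1 : (1 + r * |x|) ^ (-(2 + γ)) * (1 + r * |x|) ^ γ = (1 + r * |x|) ^ (-2 : ℝ) := by
      rw [← Real.rpow_add hw0]
      congr 1
      ring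
    rw [Real.rpow_one, ← h1, ← hb]
    calc ‖F x‖ * (1 + |x|) ^ γ
        ≤ (C * r * (1 + r * |x|) ^ (-(2 + γ)) * ‖trigPoly M a (d * x)‖) *
          (r ^ (-γ) * (1 + r * |x|) ^ γ) := by
          have := hF x
          have := one_add_abs_rpow_le hr hr1 hγ x
          gcongr
      _ = _ := by ring
  calc _ ≤ ∫⁻ x, ENNReal.ofReal (C * r * r ^ (-γ)) *
        ENNReal.ofReal (‖trigPoly N b (d * x)‖ ^ 2 * (1 + r * |x|) ^ (-2 : ℝ)) := by
        refine lintegral_mono fun x => ?_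
        rw [← ENNReal.ofReal_mul (by positivity)]
        exact ENNReal.ofReal_le_ofReal (hpt x)
    _ ≤ ENNReal.ofReal (C * r * r ^ (-γ)) * ENNReal.ofReal (16 * decayMass / r * B) := by
        rw [lintegral_const_mul' _ _ ENNReal.ofReal_ne_top]
        gcongr
        exact (lintegral_trigPoly_mul_decay_le hd N b hr hr1).trans (ENNReal.ofReal_le_ofReal
          (by gcongr))
    _ = _ := by
        rw [← ENNReal.ofReal_mul (by positivity)]
        congr 1
        field_simp

end Estimates

theorem norm_le_sqrt_of_lintegral_le (f : L2R) {A : ℝ} (hA : 0 ≤ A)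
    (h : ∫⁻ x, ENNReal.ofReal (‖f x‖ ^ (2 : ℝ) * (1 + |x|) ^ (0 : ℝ)) ≤ ENNReal.ofReal A) :
    ‖f‖ ≤ √A := by
  have h0 : polyMeasure 0 = volume := by simp [polyMeasure]
  have h1 := eLpNorm_polyMeasure (p := 2) (by norm_num) 0 f
  rw [h0, ENNReal.ofReal_ofNat] at h1
  rw [Lp.norm_def, h1]
  refine ENNReal.toReal_le_of_le_ofReal (by positivity) ?_
  rw [Real.sqrt_eq_rpow, ← ENNReal.ofReal_rpow_of_nonneg hA (by norm_num)]
  exact ENNReal.rpow_le_rpow h (by norm_num)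

theorem exists_scales {γ κ : ℝ} (hγ : 0 ≤ γ) (h : 0 < γ → κ < 1 / (2 * γ)) :
    ∃ (L : ℕ) (ρ : ℝ), 2 ≤ L ∧ 0 < ρ ∧ ρ ≤ 1 / 2 ∧ ρ ^ (-γ) * (L : ℝ) ^ (-(1 / 2) : ℝ) < 1 ∧
      ρ * (L : ℝ) ^ κ < 1 := by
  obtain ⟨β, hβγ, hβκ⟩ : ∃ β, 2 * γ < β ∧ κ * β < 1 := by
    rcases le_or_gt κ 0 with hκ | hκ
    · refine ⟨2 * γ + 1, by linarith, ?_⟩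
      nlinarith
    · have h2 : 2 * γ < 1 / κ := by
        rcases hγ.eq_or_lt with h0 | h0
        · rw [← h0, mul_zero]
          positivity
        · have := h h0
          rw [lt_div_iff₀ (by positivity)] at this ⊢
          linarith
      obtain ⟨β, h3, h4⟩ := exists_between h2
      refine ⟨β, h3, ?_⟩
      rw [lt_div_iff₀ hκ] at h4
      linarith
  have hβ : 0 < β := by linarith
  -- The bound L ≥ 2^β makes ρ = L^{-1/β} at most 1/2.
  obtain ⟨L, hL⟩ := exists_nat_ge (max 2 ((2 : ℝ) ^ β))
  have hL2 : (2 : ℝ) ≤ L := (le_max_left _ _).trans hL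
  have hL0 : (0 : ℝ) < L := by linarith
  have hL1 : (1 : ℝ) < L := by linarith
  refine ⟨L, (L : ℝ) ^ (-(1 / β)), by exact_mod_cast hL2, by positivity, ?_, ?_, ?_⟩
  · rw [Real.rpow_neg hL0.le, ← one_div]
    refine one_div_le_one_div_of_le (by norm_num) ?_
    calc (2 : ℝ) = ((2 : ℝ) ^ β) ^ (1 / β) := by
          rw [← Real.rpow_mul (by norm_num), mul_one_div_cancel hβ.ne', Real.rpow_one]
      _ ≤ _ := Real.rpow_le_rpow (by positivity) ((le_max_right _ _).trans hL) (by positivity)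
  · rw [← Real.rpow_mul hL0.le, ← Real.rpow_add hL0]
    refine Real.rpow_lt_one_of_one_lt_of_neg hL1 ?_
    have : γ / β < 1 / 2 := by
      rw [div_lt_div_iff₀ hβ (by norm_num)]
      linarith
    have e : -(1 / β) * -γ + -(1 / 2) = γ / β - 1 / 2 := by ring
    linarith
  · rw [← Real.rpow_add hL0]
    refine Real.rpow_lt_one_of_one_lt_of_neg hL1 ?_
    have : κ < 1 / β := by
      rw [lt_div_iff₀ hβ]
      exact hβκ
    linarith

end ShiftInvariant

/-! ### Construction of the generator. -/

namespace ShiftInvariant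

section Construction

/-- Dominated convergence: the squared bumps dominate and sum to 1 off the null set of endpoints. -/
theorem hasSum_integral_exp_mul_sq_endBump {ρ : ℝ} (hρ : 0 < ρ) (hρ2 : ρ ≤ 1 / 2) (t : ℝ) :
    HasSum (fun i : Bool × ℕ => ∫ s in (0 : ℝ)..1,
      Complex.exp (2 * Real.pi * Complex.I * (-t : ℝ) * s) *
        ((endBump ρ i.1 (ρ ^ i.2 / 3) s ^ 2 : ℝ) : ℂ))
      (∫ s in (0 : ℝ)..1, Complex.exp (2 * Real.pi * Complex.I * (-t : ℝ) * s)) := by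
  have hae : ∀ᵐ s : ℝ, s ∈ Set.uIoc (0 : ℝ) 1 → s ∈ Set.Ioo (0 : ℝ) 1 := by
    filter_upwards [Measure.ae_ne volume (1 : ℝ)] with s hs h
    rw [Set.uIoc_of_le zero_le_one] at h
    exact ⟨h.1, lt_of_le_of_ne h.2 hs⟩
  refine intervalIntegral.hasSum_integral_of_dominated_convergence
    (fun i s => endBump ρ i.1 (ρ ^ i.2 / 3) s ^ 2) (fun i => ?_) (fun i => ?_) ?_ ?_ ?_
  · have := (contDiff_endBump ρ i.1 (ρ ^ i.2 / 3)).continuous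
    exact Continuous.aestronglyMeasurable (by fun_prop)
  · refine Filter.Eventually.of_forall fun s _ => ?_
    rw [norm_mul, Complex.norm_real, Real.norm_of_nonneg (by positivity)]
    refine mul_le_of_le_one_left (by positivity) (le_of_eq ?_)
    rw [← Complex.norm_exp_ofReal_mul_I (2 * Real.pi * (-t) * s)]
    congr 2
    push_cast
    ring
  · filter_upwards [hae] with s hs h
    exact (hasSum_sq_endBump hρ hρ2 (hs h)).summable
  · refine (intervalIntegrable_const (c := (1 : ℝ))).congr_ae ?_
    rw [Filter.EventuallyEq, ae_restrict_iff' measurableSet_uIoc]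
    filter_upwards [hae] with s hs h
    exact (hasSum_sq_endBump hρ hρ2 (hs h)).tsum_eq.symm
  · filter_upwards [hae] with s hs h
    have h1 : HasSum (fun i : Bool × ℕ => ((endBump ρ i.1 (ρ ^ i.2 / 3) s ^ 2 : ℝ) : ℂ)) 1 := by
      rw [← Complex.ofReal_one]
      exact Complex.hasSum_ofReal.2 (hasSum_sq_endBump hρ hρ2 (hs h))
    simpa using h1.mul_left (Complex.exp (2 * Real.pi * Complex.I * (-t : ℝ) * s))

theorem fourier_tsum_invFourierLp {ι : Type*} (v : ι → SchwartzMap ℝ ℂ) :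
    𝓕 (∑' i, invFourierLp (v i)) = ∑' i, ((v i).toLp 2 : L2R) := by
  have := (Lp.fourierTransformₗᵢ ℝ ℂ).toContinuousLinearEquiv.map_tsum
    (L := SummationFilter.unconditional ι) (f := fun i => invFourierLp (v i))
  refine this.trans (tsum_congr fun i => fourier_invFourierLp (v i))

theorem lintegral_weight_congr {f : L2R} {g : ℝ → ℂ} (h : (f : ℝ → ℂ) =ᵐ[volume] g) (p s : ℝ) :
    ∫⁻ x, ENNReal.ofReal (‖f x‖ ^ p * (1 + |x|) ^ s) =
      ∫⁻ x, ENNReal.ofReal (‖g x‖ ^ p * (1 + |x|) ^ s) := by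
  refine lintegral_congr_ae ?_
  filter_upwards [h] with x hx
  rw [hx]

theorem sqrt_two_div_pow (L j : ℕ) : √(2 / ((L ^ j : ℕ) : ℝ)) =
    √2 * ((L : ℝ) ^ (-(1 / 2) : ℝ)) ^ j := by
  rw [Real.sqrt_div (by norm_num), Nat.cast_pow, div_eq_mul_inv, Real.rpow_neg (by positivity),
    ← Real.sqrt_eq_rpow, inv_pow, Real.sqrt_eq_rpow ((L : ℝ) ^ j), Real.sqrt_eq_rpow (L : ℝ),
    ← Real.rpow_natCast, ← Real.rpow_natCast, ← Real.rpow_mul (by positivity),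
    ← Real.rpow_mul (by positivity), mul_comm (j : ℝ)]

theorem div_three_rpow {ρ : ℝ} (hρ : 0 < ρ) (j : ℕ) (e : ℝ) :
    (ρ ^ j / 3) ^ e = (1 / 3) ^ e * (ρ ^ e) ^ j := by
  rw [div_eq_mul_one_div, Real.mul_rpow (by positivity) (by positivity), mul_comm,
    ← Real.rpow_natCast, ← Real.rpow_natCast, ← Real.rpow_mul hρ.le, ← Real.rpow_mul hρ.le,
    mul_comm (j : ℝ)]

/-- Collects the powers of N = L^j: 1 from the number of cells, -q/2 from the amplitudes, δ from the
weight. -/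
theorem piece_bound_le {L n : ℕ} (hL : 2 ≤ L) (hn : n ≠ 0) {ρ : ℝ} (hρ : 0 < ρ) (j : ℕ)
    {q δ : ℝ} (hδ : 0 ≤ δ) :
    4 * ((L ^ j : ℕ) : ℝ) * (ρ ^ j / 3) *
      (√(2 / ((L ^ j : ℕ) : ℝ)) ^ q * (1 + 8 * n * ((L ^ j : ℕ) : ℝ)) ^ δ) ≤
    4 / 3 * √2 ^ q * (9 * n) ^ δ * (ρ * (L : ℝ) ^ (1 + δ - q / 2)) ^ j := by
  have hL0 : (0 : ℝ) < L := by
    have : 0 < L := by omega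
    exact_mod_cast this
  have hn1 : (1 : ℝ) ≤ n := by exact_mod_cast Nat.one_le_iff_ne_zero.2 hn
  set N : ℝ := ((L ^ j : ℕ) : ℝ) with hN
  have hN1 : 1 ≤ N := by
    rw [hN]
    exact_mod_cast Nat.one_le_pow _ _ (by omega)
  have hN0 : 0 < N := by linarith
  have h1 : (1 + 8 * n * N) ^ δ ≤ (9 * n) ^ δ * N ^ δ := by
    rw [← Real.mul_rpow (by positivity) hN0.le]
    refine Real.rpow_le_rpow (by positivity) ?_ hδ
    nlinarith
  have h2 : √(2 / N) ^ q = √2 ^ q * N ^ (-(q / 2)) := by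
    rw [Real.sqrt_div (by norm_num), div_eq_mul_inv, Real.mul_rpow (by positivity) (by positivity),
      Real.inv_rpow (by positivity), Real.sqrt_eq_rpow N, ← Real.rpow_mul hN0.le,
      Real.rpow_neg hN0.le]
    congr 3
    ring
  have h3 : (ρ * (L : ℝ) ^ (1 + δ - q / 2)) ^ j = ρ ^ j * (N * N ^ (-(q / 2)) * N ^ δ) := by
    have h4 : N * N ^ (-(q / 2)) * N ^ δ = N ^ (1 + δ - q / 2) := by
      nth_rewrite 1 [← Real.rpow_one N]
      rw [← Real.rpow_add hN0, ← Real.rpow_add hN0]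
      congr 1
      ring
    rw [h4, mul_pow, hN, Nat.cast_pow, ← Real.rpow_natCast (L : ℝ), ← Real.rpow_mul hL0.le,
      ← Real.rpow_natCast ((L : ℝ) ^ _), ← Real.rpow_mul hL0.le, mul_comm (j : ℝ)]
  rw [h2, h3]
  calc _ ≤ 4 * N * (ρ ^ j / 3) * (√2 ^ q * N ^ (-(q / 2)) * ((9 * n) ^ δ * N ^ δ)) := by gcongr
    _ = _ := by ring

theorem exists_localized_generator {n : ℕ} (hn : n ≠ 0) {s γ δ q : ℝ} (hs : 0 ≤ s) (hs1 : s < 1)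
    (hγ : 0 ≤ γ) (hδ : 0 < δ) (hq : 1 ≤ q) (h : 0 < γ → 1 + δ - q / 2 < 1 / (2 * γ)) :
    ∃ φ : L2R, IsOrthonormalGenerator φ ∧ IsFractionallyInvariant n (generatedSpace φ) ∧
      Integrable (fun x : ℝ => ‖φ x‖ ^ (2 : ℝ) * (1 + |x|) ^ s) volume ∧
      Integrable (fun x : ℝ => ‖φ x‖ ^ (1 : ℝ) * (1 + |x|) ^ γ) volume ∧
      Integrable (fun ξ : ℝ => ‖(𝓕 φ : L2R) ξ‖ ^ q * (1 + |ξ|) ^ δ) volume := by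
  obtain ⟨L, ρ, hL, hρ, hρ2, hθ₂, hθ₃⟩ := exists_scales hγ h
  have hρ1 : ρ < 1 := by linarith
  have hNne : ∀ j : ℕ, L ^ j ≠ 0 := fun j => pow_ne_zero _ (by omega)
  choose a b ha hab hfac hb using fun j : ℕ => exists_flat_coefficients (hNne j)
  -- The γ absorbs the L¹ weight; the 2 leaves an integrable factor.
  obtain ⟨C, hC, hdecay⟩ := exists_ringWave_decay hρ (2 + γ)
  have hr : ∀ j : ℕ, 0 < ρ ^ j / 3 := fun j => by positivity
  have hr3 : ∀ j : ℕ, ρ ^ j / 3 ≤ 1 / 3 := fun j => by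
    have := pow_le_one₀ hρ.le hρ1.le (n := j)
    linarith
  have hr1 : ∀ j : ℕ, ρ ^ j / 3 ≤ 1 := fun j => (hr3 j).trans (by norm_num)
  have hd : 2 * n ≠ 0 := by omega
  obtain ⟨v, hv⟩ : ∃ v : Bool × ℕ → SchwartzMap ℝ ℂ, ∀ i,
      (v i : ℝ → ℂ) = piece ρ n (L ^ i.2) i.1 (ρ ^ i.2 / 3) (a i.2) :=
    ⟨fun i => (hasCompactSupport_piece hρ (hr i.2) (hr3 i.2)).toSchwartzMap
      (contDiff_piece _ _ _ _ _ _), fun _ => rfl⟩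
  have hvc : ∀ i, HasCompactSupport (v i) := fun i => by
    rw [hv]
    exact hasCompactSupport_piece hρ (hr i.2) (hr3 i.2)
  obtain ⟨F, hFdef⟩ : ∃ F : Bool × ℕ → ℝ → ℂ, ∀ i x, F i x =
    ∫ ξ : ℝ, Complex.exp (2 * Real.pi * Complex.I * x * ξ) * v i ξ := ⟨_, fun _ _ => rfl⟩
  have hFae : ∀ i, (invFourierLp (v i) : ℝ → ℂ) =ᵐ[volume] F i := fun i => by
    filter_upwards [coeFn_invFourierLp (v i)] with x hx
    rw [hx, hFdef]
  have hF : ∀ i x, ‖F i x‖ ≤ C * (ρ ^ i.2 / 3) * (1 + ρ ^ i.2 / 3 * |x|) ^ (-(2 + γ)) *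
      ‖trigPoly (2 * L ^ i.2) (fun m => (a i.2 m : ℂ)) ((2 * n : ℕ) * x)‖ := by
    intro i x
    obtain ⟨y, hy, hnorm⟩ := norm_integral_exp_mul_piece (n := n) (N := L ^ i.2) (b := i.1)
      (a := a i.2) hρ (hr i.2) (hr3 i.2) x
    rw [hFdef, hv, hnorm]
    have h1 := hdecay y
    rw [hy] at h1
    have h2 := (hr i.2).le
    refine mul_le_mul_of_nonneg_right ?_ (norm_nonneg _)
    calc ρ ^ i.2 / 3 * ‖ringWave ρ y‖
        ≤ ρ ^ i.2 / 3 * (C * (1 + ρ ^ i.2 / 3 * |x|) ^ (-(2 + γ))) :=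
          mul_le_mul_of_nonneg_left h1 h2
      _ = _ := by ring
  have ha' : ∀ j, ∑ m ∈ Finset.range (2 * L ^ j), ‖(a j m : ℂ)‖ ^ 2 = 1 := by
    intro j
    simpa [sq_abs] using ha j
  have hD := decayMass_nonneg
  -- Used with u = 0 for convergence of the series in L² and with u = s for the weighted bound.
  have hsq : ∀ (u : ℝ), 0 ≤ u → u ≤ 1 → ∀ i : Bool × ℕ,
      ∫⁻ x, ENNReal.ofReal (‖invFourierLp (v i) x‖ ^ (2 : ℝ) * (1 + |x|) ^ u) ≤
      ENNReal.ofReal (16 * decayMass * C ^ 2 * (1 / 3) ^ (1 - u) * (ρ ^ (1 - u)) ^ i.2) := by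
    intro u hu hu1 i
    rw [lintegral_weight_congr (hFae i)]
    refine (lintegral_sq_mul_le (hr i.2) (hr1 i.2) hd hγ (hF i) (ha' i.2) hu hu1).trans_eq ?_
    rw [div_three_rpow hρ]
    congr 1
    ring
  have hsum : Summable fun i => ‖invFourierLp (v i)‖ := by
    refine Summable.of_nonneg_of_le (fun _ => norm_nonneg _)
      (fun i => norm_le_sqrt_of_lintegral_le _ (by positivity) (hsq 0 le_rfl zero_le_one i)) ?_
    have hg : Summable fun j : ℕ => √(16 * decayMass * C ^ 2 * (1 / 3) ^ (1 - 0 : ℝ)) * √ρ ^ j :=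
      (summable_geometric_of_lt_one (Real.sqrt_nonneg _)
        ((Real.sqrt_lt' one_pos).2 (by simpa using hρ1))).mul_left _
    refine hg.comp_bool_prod_snd.congr fun i => ?_
    have h2 : √(ρ ^ i.2) = √ρ ^ i.2 := by
      rw [Real.sqrt_eq_iff_mul_self_eq (by positivity) (by positivity), ← mul_pow,
        Real.mul_self_sqrt hρ.le]
    rw [Real.sqrt_mul (by positivity) ((ρ ^ (1 - 0 : ℝ)) ^ i.2), sub_zero, Real.rpow_one,
      Real.rpow_one, h2]
  have hdisj : ∀ i j, i ≠ j → ∀ ξ, v i ξ = 0 ∨ v j ξ = 0 := by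
    intro i j hij ξ
    rw [hv, hv]
    exact piece_disjoint hρ hn (hr i.2) (hr3 i.2) (hr j.2) (hr3 j.2)
      (fun m m' hm hm' heq => hij (cellIndex_pow_inj hL hm hm' heq)) ξ
  have hdiag : ∀ k : ℤ, HasSum (fun i => ∫ ξ : ℝ,
      Complex.exp (2 * Real.pi * Complex.I * (-((k : ℝ) / n) : ℝ) * ξ) * ((‖v i ξ‖ ^ 2 : ℝ) : ℂ))
      (∫ s in (0 : ℝ)..1, Complex.exp (2 * Real.pi * Complex.I * (-((k : ℝ) / n) : ℝ) * s)) := by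
    intro k
    have h1 := hasSum_integral_exp_mul_sq_endBump hρ hρ2 ((k : ℝ) / n)
    convert h1 using 2 with i
    rw [hv]
    exact integral_exp_mul_norm_sq_piece hρ hn (hr i.2) (hr3 i.2) (ha i.2) k
  obtain ⟨hgen, hinv⟩ := generator_of_inner_eq (φ := ∑' i, invFourierLp (v i)) hn fun k =>
    inner_translate_tsum hvc hsum hdisj (hdiag k)
  refine ⟨∑' i, invFourierLp (v i), hgen, hinv, ?_, ?_, ?_⟩
  · exact integrable_tsum_of_geometric hsum one_le_two s (by positivity) (by positivity)
      (Real.rpow_lt_one hρ.le hρ1 (by linarith)) (hsq s hs hs1.le)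
  · refine integrable_tsum_of_geometric hsum le_rfl γ
      (C := 16 * decayMass * C * (1 / 3) ^ (-γ) * √2) (by positivity) (by positivity) hθ₂
      fun i => ?_
    rw [lintegral_weight_congr (hFae i)]
    refine (lintegral_norm_mul_le (hr i.2) (hr1 i.2) hd hγ hC (hF i) (hfac i.2)
      (hb i.2)).trans_eq ?_
    rw [div_three_rpow hρ, sqrt_two_div_pow, mul_pow]
    congr 1
    ring
  · rw [fourier_tsum_invFourierLp]
    have hsum' : Summable fun i => ‖((v i).toLp 2 : L2R)‖ := by
      refine hsum.congr fun i => ?_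
      rw [← fourier_invFourierLp, Lp.norm_fourier_eq]
    refine integrable_tsum_of_geometric hsum' hq δ (C := 4 / 3 * √2 ^ q * (9 * n) ^ δ)
      (by positivity) (by positivity) hθ₃ fun i => ?_
    rw [lintegral_weight_congr ((v i).coeFn_toLp 2 volume), hv]
    refine (lintegral_piece_le hρ hn (hr i.2) (hr3 i.2) (by linarith) hδ.le
      (B := √(2 / ((L ^ i.2 : ℕ) : ℝ))) fun m => ?_).trans
      (ENNReal.ofReal_le_ofReal (piece_bound_le hL hn hρ i.2 hδ.le))
    rw [abs_of_nonneg (hab i.2 m).1]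
    exact (hab i.2 m).2

end Construction

end ShiftInvariant

theorem mainTheorem5 (n : ℕ) (hn : 2 ≤ n) (ε γ δ q : ℝ) (hε : 0 < ε) (hγ : 0 ≤ γ) (hδ : 0 < δ)
    (hq : 1 ≤ q) (h : 0 < γ → 1 + δ - q / 2 < 1 / (2 * γ)) :
    ∃ φ : ShiftInvariant.L2R,
      ShiftInvariant.IsOrthonormalGenerator φ ∧
      ShiftInvariant.IsFractionallyInvariant n (ShiftInvariant.generatedSpace φ) ∧
      Integrable (fun x : ℝ => ‖φ x‖ ^ 2 * (1 + |x|) ^ (1 - ε)) volume ∧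
      Integrable (fun x : ℝ => ‖φ x‖ * (1 + |x|) ^ γ) volume ∧
      Integrable (fun ξ : ℝ => ‖(𝓕 φ : ShiftInvariant.L2R) ξ‖ ^ q * (1 + |ξ|) ^ δ) volume := by
  -- The construction needs a nonnegative exponent; for ε > 1 the exponent 0 dominates 1 - ε.
  obtain ⟨φ, h1, h2, h3, h4, h5⟩ := ShiftInvariant.exists_localized_generator (n := n)
    (s := max 0 (1 - ε)) (by omega) (le_max_left _ _) (max_lt one_pos (by linarith)) hγ hδ hq h
  refine ⟨φ, h1, h2, h3.mono' ?_ (Filter.Eventually.of_forall fun x => ?_), by simpa using h4, h5⟩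
  · have hw : Measurable fun x : ℝ => (1 + |x|) ^ (1 - ε) := by fun_prop
    exact ((Lp.aestronglyMeasurable φ).norm.pow 2).mul hw.aestronglyMeasurable
  · rw [Real.norm_of_nonneg (by positivity), Real.rpow_two]
    refine mul_le_mul_of_nonneg_left ?_ (by positivity)
    exact Real.rpow_le_rpow_of_exponent_le (by linarith [abs_nonneg x]) (le_max_right _ _)
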